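/- \textbf{Theorem.} Let $\mathbb{N}=\{1,2,3,\dots\}$ and $\mathbb{N}_0=\mathbb{N}\cup\{0\}$. A \emph{system} $(X,T)$ is a compact metric space $X$ with a continuous map $T\colon X\to X$. A point $x\in X$ is \emph{transitive} if its forward orbit $\{T^nx: n\in\mathbb{N}_0\}$ is dense in $X$, and $(X,T)$ is \emph{minimal} if every point of $X$ is transitive. It is \emph{uniquely ergodic} if there is exactly one Borel probability measure $\mu$ on $X$ with $\mu(T^{-1}A)=\mu(A)$ for every Borel set $A\subset X$, and \emph{strictly ergodic} if it is uniquely ergodic and minimal. It has \emph{zero entropy} if its topological entropy $h(T)$ is $0$. Let $\mathcal{C}$ be a class of systems and $S\subset\mathbb{N}$. The set $S$ is an \emph{interpolation set for $\mathcal{C}$} if for every bounded $f\colon S\to\mathbb{C}$ there are a system $(X,T)\in\mathcal{C}$, a transitive point $x\in X$ and a continuous function $F\colon X\to\mathbb{C}$ with $F(T^nx)=f(n)$ for every $n\in S$. It is a \emph{weak interpolation set of all orders for $\mathcal{C}$} if for every $k\in\mathbb{N}$ the same holds for every $f\colon S\to\{0,\dots,k-1\}$ in place of the bounded functions $f\colon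 S\to\mathbb{C}$. The \emph{upper Banach density} of $S$ is \[ d^*(S)=\sup_{(F_N)}\ \limsup_{N\to\infty}\frac{|S\cap F_N|}{|F_N|}, \] where the supremum is over all sequences $(F_N)_{N\in\mathbb{N}}$ of intervals in $\mathbb{N}$ with $|F_N|\to\infty$. For every $S\subset\mathbb{N}$ the following are equivalent: \begin{enumerate} \item $S$ is a weak interpolation set of all orders for uniquely ergodic systems; \item $S$ is an interpolation set for uniquely ergodic systems; \item $S$ is an interpolation set for strictly ergodic systems; \item $S$ is an interpolation set for strictly ergodic systems of zero entropy; \item $d^*(S)=0$. \end{enumerate} -/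

import Mathlib

open Filter MeasureTheory

/-- A topological dynamical system: a compact metric space with a continuous self-map.
Every compact metric space has at most continuum many points, so that the systems with carrier
in `Type` represent all of them up to isometric conjugacy. -/
structure TopDynSystem where
  carrier : Type
  [metric : MetricSpace carrier]
  [compact : CompactSpace carrier]
  map : carrier → carrier
  continuous_map : Continuous map

namespace TopDynSystem

instance : CoeSort TopDynSystem Type := ⟨TopDynSystem.carrier⟩

variable (X : TopDynSystem)

instance : MetricSpace X := X.metric

instance : CompactSpace X := X.compact

instance : MeasurableSpace X := borel X

instance : BorelSpace X := ⟨rfl⟩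

/-- A point is transitive if its forward orbit `{T^n x : n = 0, 1, 2, …}` is dense. -/
def IsTransitivePoint (x : X) : Prop :=
  Dense (Set.range fun n : ℕ => X.map^[n] x)

/-- A system is minimal if every forward orbit is dense. -/
def IsMinimal : Prop :=
  ∀ x : X, X.IsTransitivePoint x

/-- A system is uniquely ergodic if it has exactly one invariant Borel probability measure. -/
def IsUniquelyErgodic : Prop :=
  ∃! μ : Measure X, IsProbabilityMeasure μ ∧ MeasurePreserving X.map μ μ

/-- A system is strictly ergodic if it is uniquely ergodic and minimal. -/
def IsStrictlyErgodic : Prop :=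
  X.IsUniquelyErgodic ∧ X.IsMinimal

/-- The (Bowen–Dinaburg) topological entropy of the system. -/
noncomputable def entropy : EReal :=
  Dynamics.coverEntropy X.map Set.univ

end TopDynSystem

/-- `S` is an interpolation set for the class `C` of systems if every bounded `f : S → ℂ` has the
form `f n = F (T^n x)` for a system `(X, T)` in `C`, a transitive point `x` of `X` and a
continuous function `F : X → ℂ`. -/
def IsInterpolationSet (C : Set TopDynSystem) (S : Set ℕ) : Prop :=
  ∀ f : S → ℂ, (∃ M : ℝ, ∀ n, ‖f n‖ ≤ M) →
    ∃ X ∈ C, ∃ x : X, X.IsTransitivePoint x ∧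
      ∃ F : C(X, ℂ), ∀ n : S, F (X.map^[(n : ℕ)] x) = f n

/-- Weak interpolation of order `k`: the same for functions `f : S → {0, …, k - 1}`. -/
def IsWeakInterpolationSet (k : ℕ) (C : Set TopDynSystem) (S : Set ℕ) : Prop :=
  ∀ f : S → Fin k,
    ∃ X ∈ C, ∃ x : X, X.IsTransitivePoint x ∧
      ∃ F : C(X, ℂ), ∀ n : S, F (X.map^[(n : ℕ)] x) = ((f n : ℕ) : ℂ)

/-- Weak interpolation of order `k` for every positive integer `k`. -/
def IsWeakInterpolationSetOfAllOrders (C : Set TopDynSystem) (S : Set ℕ) : Prop :=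
  ∀ k : ℕ, 1 ≤ k → IsWeakInterpolationSet k C S

/-- The upper Banach density `d*(S)`: the supremum of `limsup |S ∩ F_N| / |F_N|` over all sequences
of intervals `F_N = {a_N, …, a_N + ℓ_N - 1}` of positive integers with `|F_N| = ℓ_N → ∞`.
All these quotients and upper limits lie in `[0, 1]`. -/
noncomputable def upperBanachDensity (S : Set ℕ) : ℝ :=
  sSup {d : ℝ | ∃ a ℓ : ℕ → ℕ, (∀ N, 1 ≤ a N) ∧ Tendsto ℓ atTop atTop ∧
    d = limsup (fun N => ((S ∩ Set.Ico (a N) (a N + ℓ N)).ncard : ℝ) / (ℓ N : ℝ)) atTop}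

/-! Necessity of density zero is a counting argument. If `S` has density at least `c > 0` in
arbitrarily long windows, then `S` can be coloured with `k > 2 / c` colours so that every colour has
density at least `c / 2` along its own sequence of windows. In a uniquely ergodic system
interpolating the colouring, each of these sequences produces the same invariant probability
measure, which then gives integral at least `c / 2` to each of `k` bump functions whose sum is at
most 1: a contradiction.

Sufficiency is a Toeplitz-like construction. Block lengths `L 0 ∣ L 1 ∣ ...` grow so fast that the
`L k`-blocks meeting `S` fill a negligible part of each `L (k + 1)`-block. One builds `L k`-periodic
sequences `v k` and a limit sequence `y` extending `f` such that `y` and `v k` differ in at most `b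
k` places of every aligned `L (k + 1)`-block (`card_ne_limit_le`), with `b k / L (k + 1) → 0`.
Moreover `v (k + 1)` starts each of its `L (k + 1)`-blocks with the first `L k` letters of `y`, and
`y` inherits some of these copies in every longer block. So `y` is Weyl almost periodic and
uniformly recurrent (`exists_seq_extending`).

In the orbit closure of `y`, recurrence gives minimality; near-periodicity makes Birkhoff averages
uniformly close, hence unique ergodicity; and long words of `y` lie in few small Hamming balls
around words of `v`, hence zero entropy. The zeroth coordinate is the interpolating function. -/

open scoped Topology Uniformity BoundedContinuousFunction

/-! ### Invariant measures from orbit segments. -/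

namespace TopDynSystem

variable (X : TopDynSystem)

/-- The average of the Dirac masses at `T^n x`, `a ≤ n < a + ℓ`. -/
noncomputable def empiricalMeasure (x : X) (a ℓ : ℕ) : Measure X :=
  (ℓ : ENNReal)⁻¹ • ∑ n ∈ Finset.range ℓ, Measure.dirac (X.map^[a + n] x)

theorem isProbabilityMeasure_empiricalMeasure (x : X) (a : ℕ) {ℓ : ℕ} (hℓ : ℓ ≠ 0) :
    IsProbabilityMeasure (X.empiricalMeasure x a ℓ) := by
  constructor
  simp only [empiricalMeasure, Measure.smul_apply, Measure.coe_finsetSum, Finset.sum_apply,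
    measure_univ, Finset.sum_const, Finset.card_range, smul_eq_mul, nsmul_eq_mul, mul_one]
  exact ENNReal.inv_mul_cancel (by exact_mod_cast hℓ) (ENNReal.natCast_ne_top ℓ)

theorem integral_empiricalMeasure (x : X) (a ℓ : ℕ) (G : C(X, ℝ)) :
    ∫ z, G z ∂(X.empiricalMeasure x a ℓ) =
      (ℓ : ℝ)⁻¹ * ∑ n ∈ Finset.range ℓ, G (X.map^[a + n] x) := by
  rw [empiricalMeasure, integral_smul_measure, integral_finsetSum_measure]
  · simp
  · intro i _
    exact (BoundedContinuousFunction.mkOfCompact G).integrable _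

theorem exists_norm_le (G : C(X, ℝ)) : ∃ C, 0 ≤ C ∧ ∀ z, |G z| ≤ C :=
  ⟨‖G‖, norm_nonneg _, fun z => G.norm_coe_le_norm z⟩

/-- **Krylov–Bogoliubov theorem**: a limit of empirical measures along longer and longer orbit
segments is invariant. -/
theorem exists_invariant_measure_of_segments (x : X) (a ℓ : ℕ → ℕ)
    (hℓ : Tendsto ℓ atTop atTop) :
    ∃ μ : Measure X, (IsProbabilityMeasure μ ∧ MeasurePreserving X.map μ μ) ∧
      ∀ (G : C(X, ℝ)) (c : ℝ),
        (∀ᶠ i in atTop, c * ℓ i ≤ ∑ n ∈ Finset.range (ℓ i), G (X.map^[a i + n] x)) →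
          c ≤ ∫ z, G z ∂μ := by
  have hpos : ∀ᶠ i in atTop, 1 ≤ ℓ i := hℓ.eventually_ge_atTop 1
  -- `ℓ i - 1 + 1` equals `ℓ i` eventually and is never zero, so that every term is a probability
  -- measure.
  let ν : ℕ → ProbabilityMeasure X := fun i =>
    ⟨X.empiricalMeasure x (a i) (ℓ i - 1 + 1),
      X.isProbabilityMeasure_empiricalMeasure x (a i) (Nat.succ_ne_zero _)⟩
  let U : Ultrafilter ℕ := hyperfilter ℕ
  have hU : (U : Filter ℕ) ≤ atTop := by
    rw [← Nat.cofinite_eq_atTop]; exact hyperfilter_le_cofinite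
  obtain ⟨μ, -, hμ⟩ := isCompact_univ.ultrafilter_le_nhds (U.map ν) (by simp)
  have hlim : Tendsto ν U (𝓝 μ) := hμ
  rw [ProbabilityMeasure.tendsto_iff_forall_integral_tendsto] at hlim
  have hlim' : ∀ G : C(X, ℝ), Tendsto (fun i => ((ℓ i : ℝ))⁻¹ *
      ∑ n ∈ Finset.range (ℓ i), G (X.map^[a i + n] x)) U (𝓝 (∫ z, G z ∂(μ : Measure X))) := by
    intro G
    refine (hlim (BoundedContinuousFunction.mkOfCompact G)).congr' ?_
    filter_upwards [hU hpos] with i hi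
    have h1 : ℓ i - 1 + 1 = ℓ i := Nat.sub_add_cancel hi
    have := X.integral_empiricalMeasure x (a i) (ℓ i - 1 + 1) G
    simp only [BoundedContinuousFunction.mkOfCompact_apply, ν, ProbabilityMeasure.coe_mk]
    rw [this, h1]
  have hmeas : Measurable X.map := X.continuous_map.measurable
  refine ⟨μ, ⟨inferInstance, hmeas, ?_⟩, ?_⟩
  · have : IsProbabilityMeasure ((μ : Measure X).map X.map) :=
      Measure.isProbabilityMeasure_map hmeas.aemeasurable
    refine ext_of_forall_integral_eq_of_IsFiniteMeasure fun f => ?_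
    rw [integral_map hmeas.aemeasurable f.continuous.aestronglyMeasurable]
    let G : C(X, ℝ) := f.toContinuousMap
    let G' : C(X, ℝ) := ⟨fun z => f (X.map z), f.continuous.comp X.continuous_map⟩
    obtain ⟨C, hC0, hC⟩ := X.exists_norm_le G
    have h0 := (hlim' G').sub (hlim' G)
    -- The averages of `G ∘ T` and `G` over a segment differ by a telescoping sum, hence by at most
    -- `2 * C / ℓ i`.
    have h2 : Tendsto (fun i => 2 * C * ((ℓ i : ℝ))⁻¹) U (𝓝 0) := by
      have : Tendsto (fun i => ((ℓ i : ℝ))⁻¹) U (𝓝 0) :=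
        (tendsto_inv_atTop_zero.comp (tendsto_natCast_atTop_atTop.comp hℓ)).mono_left hU
      simpa using this.const_mul (2 * C)
    have h3 := fun hle => sub_eq_zero.1 (tendsto_nhds_unique h0 (squeeze_zero_norm hle h2))
    refine h3 fun i => ?_
    · rw [← mul_sub, ← Finset.sum_sub_distrib, norm_mul, Real.norm_eq_abs,
        Real.norm_eq_abs, abs_of_nonneg (inv_nonneg.2 (Nat.cast_nonneg (ℓ i))), mul_comm]
      refine mul_le_mul_of_nonneg_right ?_ (by positivity)
      have : ∀ n, G' (X.map^[a i + n] x) - G (X.map^[a i + n] x) =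
          G (X.map^[a i + (n + 1)] x) - G (X.map^[a i + n] x) := by
        intro n
        rw [← add_assoc, Function.iterate_succ_apply']
        rfl
      simp only [this]
      rw [Finset.sum_range_sub (fun n => G (X.map^[a i + n] x))]
      refine (abs_sub _ _).trans ?_
      linarith [hC (X.map^[a i + ℓ i] x), hC (X.map^[a i + 0] x)]
  · intro G c hc
    refine ge_of_tendsto (hlim' G) ?_
    filter_upwards [hU hpos, hU hc] with i hi hci
    rw [inv_mul_eq_div, le_div_iff₀ (by exact_mod_cast hi)]
    exact hci

end TopDynSystem

/-! ### Upper Banach density and colourings. -/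

/-- Real suprema have junk values on unbounded sets; these bounds rule that out in the definition of
the density. -/
theorem mem_Icc_of_mem_upperBanachDensity (S : Set ℕ) :
    ∀ d ∈ {d : ℝ | ∃ a ℓ : ℕ → ℕ, (∀ N, 1 ≤ a N) ∧ Tendsto ℓ atTop atTop ∧
      d = limsup (fun N => ((S ∩ Set.Ico (a N) (a N + ℓ N)).ncard : ℝ) / (ℓ N : ℝ)) atTop},
      0 ≤ d ∧ d ≤ 1 := by
  rintro d ⟨a, ℓ, -, -, rfl⟩
  have h1 : ∀ N, ((S ∩ Set.Ico (a N) (a N + ℓ N)).ncard : ℝ) / (ℓ N : ℝ) ≤ 1 := by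
    intro N
    refine div_le_one_of_le₀ ?_ (by positivity)
    have := Set.ncard_le_ncard (Set.inter_subset_right (s := S) (t := Set.Ico (a N) (a N + ℓ N)))
      (Set.finite_Ico _ _)
    rw [Set.ncard_eq_toFinset_card' (Set.Ico _ _)] at this
    simp only [Set.toFinset_Ico, Nat.card_Ico, add_tsub_cancel_left] at this
    exact_mod_cast this
  have h0 : ∀ N, 0 ≤ ((S ∩ Set.Ico (a N) (a N + ℓ N)).ncard : ℝ) / (ℓ N : ℝ) := by
    intro N; positivity
  constructor
  · exact le_limsup_of_frequently_le (Frequently.of_forall h0)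
      (isBoundedUnder_of ⟨1, h1⟩)
  · exact limsup_le_of_le (isCoboundedUnder_le_of_le atTop h0) (Eventually.of_forall h1)

/-- A set of positive upper Banach density is dense in arbitrarily long intervals. -/
theorem exists_dense_intervals_of_upperBanachDensity_ne_zero {S : Set ℕ}
    (h : upperBanachDensity S ≠ 0) :
    ∃ c : ℝ, 0 < c ∧ ∀ N : ℕ, ∃ a ℓ : ℕ, N ≤ ℓ ∧
      c * ℓ ≤ ((S ∩ Set.Ico a (a + ℓ)).ncard : ℝ) := by
  have hb := mem_Icc_of_mem_upperBanachDensity S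
  rw [upperBanachDensity] at h
  set D := {d : ℝ | ∃ a ℓ : ℕ → ℕ, (∀ N, 1 ≤ a N) ∧ Tendsto ℓ atTop atTop ∧
      d = limsup (fun N => ((S ∩ Set.Ico (a N) (a N + ℓ N)).ncard : ℝ) / (ℓ N : ℝ)) atTop}
  have : 0 < sSup D := lt_of_le_of_ne (Real.sSup_nonneg fun d hd => (hb d hd).1) (Ne.symm h)
  have hne : D.Nonempty := by
    by_contra hD
    rw [Set.not_nonempty_iff_eq_empty.1 hD, Real.sSup_empty] at this
    exact lt_irrefl _ this
  obtain ⟨d, ⟨a, ℓ, -, hℓ, rfl⟩, hd⟩ := exists_lt_of_lt_csSup hne this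
  obtain ⟨c, hc0, hc⟩ := exists_between hd
  refine ⟨c, hc0, fun N => ?_⟩
  have hfr := frequently_lt_of_lt_limsup
    (isCoboundedUnder_le_of_le atTop (x := 0) fun N => by positivity) hc
  obtain ⟨i, hi, hi'⟩ := (hfr.and_eventually (hℓ.eventually_ge_atTop (N + 1))).exists
  refine ⟨a i, ℓ i, by omega, ?_⟩
  have : (0 : ℝ) < ℓ i := by exact_mod_cast (by omega : 0 < ℓ i)
  exact ((lt_div_iff₀ this).1 hi).le

/-- Windows violating the conclusion at every length form a sequence competing in the supremum. A
window starting at 0 is moved to start at 1, which loses no point of `S`. -/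
theorem le_ncard_of_upperBanachDensity_eq_zero {S : Set ℕ} (hS : ∀ n ∈ S, 1 ≤ n)
    (h : upperBanachDensity S = 0) {ε : ℝ} (hε : 0 < ε) :
    ∃ N : ℕ, ∀ ℓ, N ≤ ℓ → ∀ a, ((S ∩ Set.Ico a (a + ℓ)).ncard : ℝ) ≤ ε * ℓ := by
  by_contra! hcon
  choose ℓ hℓ a ha using hcon
  have hb := mem_Icc_of_mem_upperBanachDensity S
  have hsub : ∀ N, ((S ∩ Set.Ico (a N) (a N + ℓ N)).ncard : ℝ) ≤
      ((S ∩ Set.Ico (max 1 (a N)) (max 1 (a N) + ℓ N)).ncard : ℝ) := by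
    intro N
    norm_cast
    refine Set.ncard_le_ncard ?_ ((Set.finite_Ico _ _).inter_of_right _)
    rintro n ⟨hn, hn1, hn2⟩
    have := hS n hn
    exact ⟨hn, by simp; omega, by omega⟩
  have hlim : Tendsto ℓ atTop atTop := tendsto_atTop_mono hℓ tendsto_id
  let u : ℕ → ℝ := fun N =>
    ((S ∩ Set.Ico (max 1 (a N)) (max 1 (a N) + ℓ N)).ncard : ℝ) / (ℓ N : ℝ)
  have hmem : limsup u atTop ∈ {d : ℝ | ∃ a ℓ : ℕ → ℕ, (∀ N, 1 ≤ a N) ∧ Tendsto ℓ atTop atTop ∧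
      d = limsup (fun N => ((S ∩ Set.Ico (a N) (a N + ℓ N)).ncard : ℝ) / (ℓ N : ℝ)) atTop} :=
    ⟨fun N => max 1 (a N), ℓ, fun N => le_max_left _ _, hlim, rfl⟩
  have hle : limsup u atTop ≤ 0 := by
    rw [← h]
    exact le_csSup ⟨1, fun d hd => (hb d hd).2⟩ hmem
  have hge : ε ≤ limsup u atTop := by
    refine le_limsup_of_frequently_le ?_ ?_
    · refine Eventually.frequently ?_
      filter_upwards [hlim.eventually_ge_atTop 1] with N hN
      rw [le_div_iff₀ (by exact_mod_cast hN)]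
      exact (ha N).le.trans (hsub N)
    · refine isBoundedUnder_of ⟨1, fun N => ?_⟩
      refine div_le_one_of_le₀ ?_ (by positivity)
      have := Set.ncard_le_ncard (Set.inter_subset_right (s := S)
        (t := Set.Ico (max 1 (a N)) (max 1 (a N) + ℓ N))) (Set.finite_Ico _ _)
      rw [Set.ncard_eq_toFinset_card' (Set.Ico _ _)] at this
      simp only [Set.toFinset_Ico, Nat.card_Ico, add_tsub_cancel_left] at this
      exact_mod_cast this
  linarith

/-- A set which is dense in arbitrarily long intervals has colorings all of whose color classes
have that property. -/
theorem exists_coloring_of_dense_intervals {S : Set ℕ} {c : ℝ} (hc : 0 < c)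
    (h : ∀ N : ℕ, ∃ a ℓ : ℕ, N ≤ ℓ ∧ c * ℓ ≤ ((S ∩ Set.Ico a (a + ℓ)).ncard : ℝ))
    {k : ℕ} (hk : 1 ≤ k) :
    ∃ f : ℕ → Fin k, ∀ j : Fin k, ∃ a ℓ : ℕ → ℕ, Tendsto ℓ atTop atTop ∧
      ∀ i, c / 2 * ℓ i ≤ (({n ∈ S | f n = j} ∩ Set.Ico (a i) (a i + ℓ i)).ncard : ℝ) := by
  -- A dense window with `B ≤ c / 2 * ℓ` keeps half of its density after the points below `B` are
  -- discarded, so infinitely many disjoint stages each contain a dense piece.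
  have key : ∀ B : ℕ, ∃ B' a ℓ : ℕ, B < B' ∧ B ≤ ℓ ∧
      c / 2 * ℓ ≤ ((S ∩ Set.Ico B B' ∩ Set.Ico a (a + ℓ)).ncard : ℝ) := by
    intro B
    obtain ⟨a, ℓ, hℓ, hd⟩ := h (max B ⌈(B : ℝ) / (c / 2)⌉₊)
    refine ⟨B + 1 + a + ℓ, a, ℓ, by omega, (le_max_left _ _).trans hℓ, ?_⟩
    have h1 : (S ∩ Set.Ico a (a + ℓ)).ncard ≤
        (S ∩ Set.Ico B (B + 1 + a + ℓ) ∩ Set.Ico a (a + ℓ)).ncard + (Set.Ico 0 B).ncard := by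
      refine (Set.ncard_le_ncard (t := (S ∩ Set.Ico B (B + 1 + a + ℓ) ∩ Set.Ico a (a + ℓ)) ∪
        Set.Ico 0 B) ?_ (((Set.finite_Ico _ _).inter_of_right _).union (Set.finite_Ico _ _))).trans
        (Set.ncard_union_le _ _)
      rintro n ⟨hn, hn1, hn2⟩
      by_cases hB : n < B
      · exact Or.inr ⟨Nat.zero_le _, hB⟩
      · exact Or.inl ⟨⟨hn, by omega, by omega⟩, hn1, hn2⟩
    have h2 : (Set.Ico 0 B).ncard = B := by
      rw [Set.ncard_eq_toFinset_card']; simp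
    have h3 : (B : ℝ) ≤ c / 2 * ℓ := by
      have : (B : ℝ) / (c / 2) ≤ ℓ :=
        (Nat.le_ceil _).trans (by exact_mod_cast (le_max_right _ _).trans hℓ)
      rw [div_le_iff₀ (by positivity)] at this
      linarith
    rw [h2] at h1
    have h4 : ((S ∩ Set.Ico a (a + ℓ)).ncard : ℝ) ≤
        ((S ∩ Set.Ico B (B + 1 + a + ℓ) ∩ Set.Ico a (a + ℓ)).ncard : ℝ) + B := by
      exact_mod_cast h1
    linarith
  choose next A L hnext hL hcount using key
  let b : ℕ → ℕ := fun i => next^[i] 0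
  have hbs : ∀ i, b (i + 1) = next (b i) := fun i => Function.iterate_succ_apply' _ _ _
  have hb : StrictMono b := strictMono_nat_of_lt_succ fun i => by rw [hbs]; exact hnext _
  -- The index of the stage `[b i, b (i + 1))` containing `n`. Colouring by `idx n % k` gives each
  -- colour infinitely many stages.
  let idx : ℕ → ℕ := fun n => Nat.findGreatest (fun i => b i ≤ n) n
  have hidx : ∀ i n, b i ≤ n → n < b (i + 1) → idx n = i := by
    intro i n h1 h2
    rw [Nat.findGreatest_eq_iff]
    refine ⟨(hb.id_le i).trans h1, fun _ => h1, fun m hm _ hbm => ?_⟩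
    have := hb.monotone (Nat.succ_le_of_lt hm)
    simp only [Nat.succ_eq_add_one] at this
    omega
  refine ⟨fun n => ⟨idx n % k, Nat.mod_lt _ hk⟩, fun j => ?_⟩
  refine ⟨fun t => A (b (j + k * t)), fun t => L (b (j + k * t)), ?_, fun t => ?_⟩
  · refine tendsto_atTop_mono (fun t => ?_) tendsto_id
    refine le_trans ?_ (hL _)
    refine le_trans ?_ (hb.id_le _)
    simp only [id]
    nlinarith
  · refine (hcount (b (j + k * t))).trans ?_
    norm_cast
    refine Set.ncard_le_ncard ?_ ((Set.finite_Ico _ _).inter_of_right _)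
    rintro n ⟨⟨hn, hn1, hn2⟩, hn3⟩
    rw [← hbs] at hn2
    refine ⟨⟨hn, ?_⟩, hn3⟩
    have := hidx _ _ hn1 hn2
    ext
    simp only [this, Nat.add_mul_mod_self_left]
    exact Nat.mod_eq_of_lt j.2

/-- The open discs of radius 1/2 about distinct integers are disjoint, so at most one summand is
nonzero. -/
theorem sum_tent_le_one (k : ℕ) (z : ℂ) :
    ∑ j : Fin k, max 0 (1 - 2 * ‖z - ((j : ℕ) : ℂ)‖) ≤ 1 := by
  by_cases h : ∃ j : Fin k, 2 * ‖z - ((j : ℕ) : ℂ)‖ < 1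
  · obtain ⟨j, hj⟩ := h
    rw [Finset.sum_eq_single j]
    · exact max_le zero_le_one (by linarith [norm_nonneg (z - ((j : ℕ) : ℂ))])
    · intro i _ hij
      refine max_eq_left ?_
      by_contra! hi
      have h1 : (1 : ℝ) ≤ ‖((i : ℕ) : ℂ) - ((j : ℕ) : ℂ)‖ := by
        have h2 : ((i : ℕ) : ℤ) - ((j : ℕ) : ℤ) ≠ 0 := by
          intro h0
          exact hij (Fin.ext (by omega))
        have h3 : ((i : ℕ) : ℂ) - ((j : ℕ) : ℂ) = ((((i : ℕ) : ℤ) - ((j : ℕ) : ℤ) : ℤ) : ℂ) := by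
          push_cast; ring
        rw [h3, Complex.norm_intCast]
        exact_mod_cast Int.one_le_abs h2
      have h4 := norm_sub_le (z - ((j : ℕ) : ℂ)) (z - ((i : ℕ) : ℂ))
      rw [sub_sub_sub_cancel_left] at h4
      linarith
    · simp
  · push Not at h
    rw [Finset.sum_eq_zero]
    · exact zero_le_one
    · intro j _
      exact max_eq_left (by linarith [h j])

theorem upperBanachDensity_eq_zero_of_isWeakInterpolationSetOfAllOrders {S : Set ℕ}
    (h : IsWeakInterpolationSetOfAllOrders {X | X.IsUniquelyErgodic} S) :
    upperBanachDensity S = 0 := by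
  by_contra hd
  obtain ⟨c, hc, hint⟩ := exists_dense_intervals_of_upperBanachDensity_ne_zero hd
  obtain ⟨k, hk⟩ := exists_nat_gt (1 / (c / 2))
  have hk0 : (0 : ℝ) < k := lt_trans (by positivity) hk
  have hk1 : 1 ≤ k := by exact_mod_cast hk0
  rw [div_lt_iff₀ (by positivity)] at hk
  obtain ⟨f, hf⟩ := exists_coloring_of_dense_intervals hc hint hk1
  obtain ⟨X, ⟨μ, ⟨hμ, -⟩, huniq⟩, x, -, F, hF⟩ := h k hk1 fun n => f n
  let G : Fin k → C(X, ℝ) := fun j =>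
    ⟨fun z => max 0 (1 - 2 * ‖F z - ((j : ℕ) : ℂ)‖), by fun_prop⟩
  have hG : ∀ j, c / 2 ≤ ∫ z, G j z ∂μ := by
    intro j
    obtain ⟨a, ℓ, hℓ, hcount⟩ := hf j
    obtain ⟨ν, hν, hνint⟩ := X.exists_invariant_measure_of_segments x a ℓ hℓ
    -- Unique ergodicity: the limit measures for the different colours all coincide with `μ`.
    rw [← huniq ν hν]
    refine hνint _ _ (Eventually.of_forall fun i => (hcount i).trans ?_)
    classical
    have h1 : ({n ∈ S | f n = j} ∩ Set.Ico (a i) (a i + ℓ i)) =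
        ((Finset.Ico (a i) (a i + ℓ i)).filter fun n => n ∈ S ∧ f n = j : Finset ℕ) := by
      ext n
      simp only [Set.mem_inter_iff, Set.mem_ofPred_eq, Set.mem_Ico, Finset.coe_filter,
        Finset.mem_Ico]
      tauto
    rw [h1, Set.ncard_coe_finset, Finset.card_filter]
    push_cast
    rw [Finset.sum_Ico_eq_sum_range, Nat.add_sub_cancel_left]
    refine Finset.sum_le_sum fun n _ => ?_
    split_ifs with hn
    · have := hF ⟨a i + n, hn.1⟩
      simp only at this
      simp [G, this, hn.2]
    · exact le_max_left _ _
  have hint : ∀ j, Integrable (G j) μ := fun j =>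
    (BoundedContinuousFunction.mkOfCompact (G j)).integrable _
  have h1 : ∑ j, ∫ z, G j z ∂μ ≤ 1 := by
    rw [← integral_finsetSum _ fun j _ => hint j]
    refine (integral_mono (integrable_finsetSum _ fun j _ => hint j) (integrable_const (1 : ℝ))
      fun z => sum_tent_le_one k (F z)).trans ?_
    simp
  have h2 := Finset.card_nsmul_le_sum Finset.univ (fun j => ∫ z, G j z ∂μ) (c / 2) fun j _ => hG j
  simp only [Finset.card_univ, Fintype.card_fin, nsmul_eq_mul] at h2
  linarith

/-! ### The block construction. -/

open scoped Classical in
/-- The sequences `Y k` and `v k` approximating a sequence which extends `f` on `S`: `v (k + 1)` is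
`v k` with the initial segment of length `L k` of every `L (k + 1)`-block replaced by the initial
segment of `Y k`; and `Y (k + 1)` is `v (k + 1)` on the `L (k + 1)`-blocks that do not meet `S`. -/
noncomputable def blockStage {K : Type*} (S : Set ℕ) (L : ℕ → ℕ) (f : ℕ → K) (z : K) :
    ℕ → (ℕ → K) × (ℕ → K)
  | 0 => (f, fun _ => z)
  | k + 1 =>
    (fun n => if ∃ s ∈ S, s / L (k + 1) = n / L (k + 1) then (blockStage S L f z k).1 n
      else if n % L (k + 1) < L k then (blockStage S L f z k).1 (n % L (k + 1))
      else (blockStage S L f z k).2 n,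
    fun n => if n % L (k + 1) < L k then (blockStage S L f z k).1 (n % L (k + 1))
      else (blockStage S L f z k).2 n)

/-- The length `L k` of the blocks of level `k` divides `L (k + 1)`, and `b k` bounds the length of
the part of a block of level `k + 1` covered by the blocks of level `k` meeting `S`. -/
structure IsBlockScale (S : Set ℕ) (L b : ℕ → ℕ) : Prop where
  zero_mem : 0 ∈ S
  zero : L 0 = 1
  dvd : ∀ k, L k ∣ L (k + 1)
  strictMono : StrictMono L
  le_bound : ∀ k, L k ≤ b k
  ncard_le : ∀ k a, (S ∩ Set.Ico a (a + L (k + 1))).ncard * L k ≤ b k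
  bound_mul_lt : ∀ k, b k * L k < L (k + 1)
  bound_mul_le : ∀ k, b k * (k + 1) ≤ L (k + 1)

namespace IsBlockScale

variable {K : Type*} {S : Set ℕ} {L b : ℕ → ℕ} (h : IsBlockScale S L b) {f : ℕ → K} {z : K}

include h

theorem pos (k : ℕ) : 0 < L k := by
  have := h.strictMono.monotone (Nat.zero_le k)
  rw [h.zero] at this
  omega

theorem dvd_of_le {k m : ℕ} (hkm : k ≤ m) : L k ∣ L m := by
  induction m, hkm using Nat.le_induction with
  | base => exact dvd_rfl
  | succ m _ ih => exact ih.trans (h.dvd m)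

theorem snd_eq_of_mod_eq (k : ℕ) {m n : ℕ} (hmn : m % L k = n % L k) :
    (blockStage S L f z k).2 m = (blockStage S L f z k).2 n := by
  induction k generalizing m n with
  | zero => rfl
  | succ k ih =>
    have h1 : m % L k = n % L k := by
      rw [← Nat.mod_mod_of_dvd m (h.dvd k), hmn, Nat.mod_mod_of_dvd n (h.dvd k)]
    simp only [blockStage, hmn, ih h1]

/-- Since `0 ∈ S`, the initial block always meets `S` and is left untouched. -/
theorem fst_succ_of_lt {k n : ℕ} (hn : n < L (k + 1)) :
    (blockStage S L f z (k + 1)).1 n = (blockStage S L f z k).1 n := by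
  have : ∃ s ∈ S, s / L (k + 1) = n / L (k + 1) :=
    ⟨0, h.zero_mem, by rw [Nat.zero_div, Nat.div_eq_of_lt hn]⟩
  simp only [blockStage, if_pos this]

theorem fst_eq_of_le {k m n : ℕ} (hkm : k ≤ m) (hn : n < L (k + 1)) :
    (blockStage S L f z m).1 n = (blockStage S L f z k).1 n := by
  induction m, hkm using Nat.le_induction with
  | base => rfl
  | succ m hkm ih =>
    rw [h.fst_succ_of_lt (hn.trans_le (h.strictMono.monotone (by omega))), ih]

theorem lt_scale (n : ℕ) : n < L (n + 1) :=
  Nat.lt_of_succ_le (h.strictMono.id_le (n + 1))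

/-- The limit sequence is the diagonal one: the value at `n` is frozen from stage `n` on, and
already from stage `k` when `n < L (k + 1)`. -/
theorem limit_eq {k n : ℕ} (hn : n < L (k + 1)) :
    (blockStage S L f z n).1 n = (blockStage S L f z k).1 n := by
  rcases le_total k n with hkn | hnk
  · exact h.fst_eq_of_le hkn hn
  · exact (h.fst_eq_of_le hnk (h.lt_scale n)).symm

omit h in
theorem fst_eq_of_mem (k : ℕ) {n : ℕ} (hn : n ∈ S) : (blockStage S L f z k).1 n = f n := by
  induction k with
  | zero => rfl
  | succ k ih =>
    have : ∃ s ∈ S, s / L (k + 1) = n / L (k + 1) := ⟨n, hn, rfl⟩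
    simp only [blockStage, if_pos this]
    exact ih

theorem snd_succ_eq_limit {k n : ℕ} (hn : n < L k) :
    (blockStage S L f z (k + 1)).2 n = (blockStage S L f z n).1 n := by
  have h1 : n < L (k + 1) := hn.trans (h.strictMono (Nat.lt_succ_self k))
  rw [h.limit_eq h1]
  simp only [blockStage, Nat.mod_eq_of_lt h1, if_pos hn]

omit h in
theorem fst_eq_snd_of_forall {k n : ℕ} (hf : ∀ n ∉ S, f n = z)
    (hn : ∀ s ∈ S, s / L k ≠ n / L k) :
    (blockStage S L f z k).1 n = (blockStage S L f z k).2 n := by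
  cases k with
  | zero => exact hf n fun hnS => hn n hnS rfl
  | succ k =>
    have : ¬ ∃ s ∈ S, s / L (k + 1) = n / L (k + 1) := by
      rintro ⟨s, hs, hsn⟩; exact hn s hs hsn
    simp only [blockStage, if_neg this]

/-- As `L k` divides `L m` and `L (m + 1)`, the replacement never cuts an aligned `L k`-block: it is
copied whole or kept whole. This lets block estimates pass to higher stages. -/
theorem snd_succ_block {k m : ℕ} (hkm : k ≤ m) (j : ℕ) :
    (∃ j', ∀ i < L k, (blockStage S L f z (m + 1)).2 (j * L k + i) =
      (blockStage S L f z m).1 (j' * L k + i)) ∨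
    ∀ i < L k, (blockStage S L f z (m + 1)).2 (j * L k + i) =
      (blockStage S L f z m).2 (j * L k + i) := by
  obtain ⟨p, hp⟩ := h.dvd_of_le hkm
  obtain ⟨q, hq⟩ := h.dvd_of_le (hkm.trans (Nat.le_succ m))
  have hD := h.pos k
  have hq0 : 0 < q := by
    have := h.pos m.succ
    rw [hq] at this
    exact Nat.pos_of_mul_pos_left this
  have hmod : ∀ i < L k, (j * L k + i) % L (m + 1) = (j % q) * L k + i := by
    intro i hi
    rw [hq]
    have h1 : j * L k + i = ((j % q) * L k + i) + (L k * q) * (j / q) := by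
      conv_lhs => rw [← Nat.mod_add_div j q]
      ring
    rw [h1, Nat.add_mul_mod_self_left, Nat.mod_eq_of_lt]
    have : j % q + 1 ≤ q := Nat.mod_lt j hq0
    nlinarith
  by_cases hj : j % q < p
  · left
    refine ⟨j % q, fun i hi => ?_⟩
    have : (j * L k + i) % L (m + 1) < L m := by rw [hmod i hi, hp]; nlinarith
    simp only [blockStage, if_pos this]
    rw [hmod i hi]
  · right
    intro i hi
    have : ¬ (j * L k + i) % L (m + 1) < L m := by rw [hmod i hi, hp]; nlinarith
    simp only [blockStage, if_neg this]

theorem fst_succ_block {k m : ℕ} (hkm : k ≤ m + 1) (j : ℕ) :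
    (∀ i < L k, (blockStage S L f z (m + 1)).1 (j * L k + i) =
      (blockStage S L f z m).1 (j * L k + i)) ∨
    ∀ i < L k, (blockStage S L f z (m + 1)).1 (j * L k + i) =
      (blockStage S L f z (m + 1)).2 (j * L k + i) := by
  obtain ⟨q, hq⟩ := h.dvd_of_le hkm
  have hD := h.pos k
  have hdiv : ∀ i < L k, (j * L k + i) / L (m + 1) = j / q := by
    intro i hi
    rw [hq, ← Nat.div_div_eq_div_mul, mul_comm, Nat.mul_add_div hD, Nat.div_eq_of_lt hi, add_zero]
  by_cases hj : ∃ s ∈ S, s / L (m + 1) = j / q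
  · left
    intro i hi
    have : ∃ s ∈ S, s / L (m + 1) = (j * L k + i) / L (m + 1) := by rwa [hdiv i hi]
    simp only [blockStage, if_pos this]
  · right
    intro i hi
    have : ¬ ∃ s ∈ S, s / L (m + 1) = (j * L k + i) / L (m + 1) := by rwa [hdiv i hi]
    simp only [blockStage, if_neg this]

open scoped Classical in
-- Stage `k` disagrees with its periodic approximation only on `L k`-blocks meeting `S`, and these
-- are at most as many as the points of `S` in the big block.
theorem card_ne_fst_le (hf : ∀ n ∉ S, f n = z) (k j : ℕ) :
    ((Finset.range (L (k + 1))).filter fun i =>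
      (blockStage S L f z k).1 (j * L (k + 1) + i) ≠ (blockStage S L f z k).2 i).card ≤ b k := by
  obtain ⟨q, hq⟩ := h.dvd k
  have hD := h.pos k
  have hfin : (S ∩ Set.Ico (j * L (k + 1)) (j * L (k + 1) + L (k + 1))).Finite :=
    (Set.finite_Ico _ _).inter_of_right _
  refine le_trans ?_ (h.ncard_le k (j * L (k + 1)))
  rw [Set.ncard_eq_toFinset_card _ hfin]
  refine le_trans (Finset.card_le_card (t := hfin.toFinset.biUnion fun s =>
    (Finset.Ico (s / L k * L k - j * L (k + 1)) (s / L k * L k - j * L (k + 1) + L k))) ?_) ?_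
  · intro i hi
    rw [Finset.mem_filter, Finset.mem_range] at hi
    obtain ⟨hi1, hi2⟩ := hi
    have h1 : (blockStage S L f z k).2 i = (blockStage S L f z k).2 (j * L (k + 1) + i) := by
      refine h.snd_eq_of_mod_eq k ?_
      rw [hq, show j * (L k * q) + i = i + L k * (j * q) by ring, Nat.add_mul_mod_self_left]
    rw [h1] at hi2
    have h2 : ∃ s ∈ S, s / L k = (j * L (k + 1) + i) / L k := by
      by_contra! hcon
      exact hi2 (fst_eq_snd_of_forall hf hcon)
    obtain ⟨s, hs, hsn⟩ := h2
    have h3 : s / L (k + 1) = j := by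
      rw [hq, ← Nat.div_div_eq_div_mul, hsn, Nat.div_div_eq_div_mul, ← hq, mul_comm,
        Nat.mul_add_div (h.pos _), Nat.div_eq_of_lt hi1, add_zero]
    have h4 := Nat.div_add_mod s (L (k + 1))
    have h5 := Nat.mod_lt s (h.pos (k + 1))
    rw [h3, mul_comm] at h4
    have h6 := Nat.div_add_mod (j * L (k + 1) + i) (L k)
    have h7 := Nat.mod_lt (j * L (k + 1) + i) hD
    rw [← hsn, mul_comm] at h6
    have h8 : j * L (k + 1) ≤ s / L k * L k := by
      rw [hsn, hq, show j * (L k * q) + i = L k * (j * q) + i by ring, Nat.mul_add_div hD]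
      calc j * (L k * q) = (j * q) * L k := by ring
        _ ≤ _ := Nat.mul_le_mul_right _ (Nat.le_add_right _ _)
    rw [Finset.mem_biUnion]
    refine ⟨s, ?_, ?_⟩
    · rw [Set.Finite.mem_toFinset]
      exact ⟨hs, by omega, by omega⟩
    · rw [Finset.mem_Ico]
      omega
  · refine Finset.card_biUnion_le_card_mul _ _ _ fun s _ => ?_
    simp

open scoped Classical in
-- Errors do not accumulate: beyond stage `k + 1`, each aligned `L (k + 1)`-block is a copy of one
-- from the previous stage, so the same bound persists.
theorem card_ne_snd_le (hf : ∀ n ∉ S, f n = z) {k m : ℕ} (hkm : k ≤ m) :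
    (∀ j, ((Finset.range (L (k + 1))).filter fun i =>
      (blockStage S L f z m).1 (j * L (k + 1) + i) ≠ (blockStage S L f z k).2 i).card ≤ b k) ∧
    ∀ j, ((Finset.range (L (k + 1))).filter fun i =>
      (blockStage S L f z m).2 (j * L (k + 1) + i) ≠ (blockStage S L f z k).2 i).card ≤ b k := by
  have congr : ∀ (g g' : ℕ → K) (j j' : ℕ),
      (∀ i < L (k + 1), g (j * L (k + 1) + i) = g' (j' * L (k + 1) + i)) →
      ((Finset.range (L (k + 1))).filter fun i =>
        g' (j' * L (k + 1) + i) ≠ (blockStage S L f z k).2 i).card ≤ b k →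
      ((Finset.range (L (k + 1))).filter fun i =>
        g (j * L (k + 1) + i) ≠ (blockStage S L f z k).2 i).card ≤ b k := by
    intro g g' j j' hg hle
    refine le_of_eq_of_le (congrArg _ (Finset.filter_congr fun i hi => ?_)) hle
    rw [hg i (Finset.mem_range.1 hi)]
  have hper : ∀ j i, (blockStage S L f z k).2 (j * L (k + 1) + i) =
      (blockStage S L f z k).2 i := by
    intro j i
    obtain ⟨q, hq⟩ := h.dvd k
    refine h.snd_eq_of_mod_eq k ?_
    rw [hq, show j * (L k * q) + i = i + L k * (j * q) by ring, Nat.add_mul_mod_self_left]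
  induction m, hkm using Nat.le_induction with
  | base =>
    refine ⟨h.card_ne_fst_le hf k, fun j => ?_⟩
    simp [hper]
  | succ m hkm ih =>
    have hsnd : ∀ j, ((Finset.range (L (k + 1))).filter fun i =>
        (blockStage S L f z (m + 1)).2 (j * L (k + 1) + i) ≠
          (blockStage S L f z k).2 i).card ≤ b k := by
      intro j
      -- For `m = k` the block is not copied whole: only its first `L k ≤ b k` letters were
      -- replaced.
      rcases hkm.eq_or_lt with rfl | hlt
      · refine le_trans ?_ (h.le_bound k)
        refine (Finset.card_le_card (t := Finset.range (L k)) ?_).trans (by simp)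
        intro i hi
        rw [Finset.mem_filter, Finset.mem_range] at hi
        obtain ⟨hi1, hi2⟩ := hi
        rw [Finset.mem_range]
        by_contra hlt
        refine hi2 ?_
        have h1 : (j * L (k + 1) + i) % L (k + 1) = i := by
          rw [mul_comm, Nat.mul_add_mod, Nat.mod_eq_of_lt hi1]
        rw [← hper j i]
        simp only [blockStage, h1, if_neg hlt]
      · rcases h.snd_succ_block (f := f) (z := z) hlt j with ⟨j', hj'⟩ | hj
        · exact congr _ _ _ _ hj' (ih.1 j')
        · exact congr _ _ _ _ hj (ih.2 j)
    refine ⟨fun j => ?_, hsnd⟩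
    rcases h.fst_succ_block (f := f) (z := z) (show k + 1 ≤ m + 1 by omega) j with hj | hj
    · exact congr _ _ _ _ hj (ih.1 j)
    · exact congr _ _ _ _ hj (hsnd j)

open scoped Classical in
theorem card_ne_limit_le (hf : ∀ n ∉ S, f n = z) (k j : ℕ) :
    ((Finset.range (L (k + 1))).filter fun i =>
      (blockStage S L f z (j * L (k + 1) + i)).1 (j * L (k + 1) + i) ≠
        (blockStage S L f z k).2 i).card ≤ b k := by
  have h1 : j * L (k + 1) + L (k + 1) < L (k + (j * L (k + 1) + L (k + 1)) + 1) :=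
    (h.lt_scale _).trans_le (h.strictMono.monotone (by omega))
  refine le_of_eq_of_le (congrArg _ (Finset.filter_congr fun i hi => ?_))
    ((h.card_ne_snd_le hf (Nat.le_add_right k (j * L (k + 1) + L (k + 1)))).1 j)
  rw [Finset.mem_range] at hi
  rw [h.limit_eq (k := k + (j * L (k + 1) + L (k + 1))) (by omega)]

end IsBlockScale

/-! ### Uniformly recurrent, Weyl almost periodic extensions. -/

/-- A set all of whose long windows have small density. -/
def HasUniformDensityZero (S : Set ℕ) : Prop :=
  ∀ ε : ℝ, 0 < ε → ∃ N : ℕ, ∀ ℓ, N ≤ ℓ → ∀ a, ((S ∩ Set.Ico a (a + ℓ)).ncard : ℝ) ≤ ε * ℓ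

theorem hasUniformDensityZero_insert {S : Set ℕ} (h : HasUniformDensityZero S) (x : ℕ) :
    HasUniformDensityZero (insert x S) := by
  intro ε hε
  obtain ⟨N, hN⟩ := h (ε / 2) (by positivity)
  refine ⟨max N ⌈1 / (ε / 2)⌉₊, fun ℓ hℓ a => ?_⟩
  have h1 : (1 : ℝ) ≤ ε / 2 * ℓ := by
    have : 1 / (ε / 2) ≤ (ℓ : ℝ) :=
      (Nat.le_ceil _).trans (by exact_mod_cast (le_max_right _ _).trans hℓ)
    rw [div_le_iff₀ (by positivity)] at this
    linarith
  have h2 := hN ℓ ((le_max_left _ _).trans hℓ) a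
  have h3 : (insert x S ∩ Set.Ico a (a + ℓ)).ncard ≤ (S ∩ Set.Ico a (a + ℓ)).ncard + 1 := by
    refine (Set.ncard_le_ncard (t := insert x (S ∩ Set.Ico a (a + ℓ))) ?_
      (((Set.finite_Ico _ _).inter_of_right _).insert _)).trans (Set.ncard_insert_le _ _)
    rintro n ⟨rfl | hn, hn'⟩
    · exact Or.inl rfl
    · exact Or.inr ⟨hn, hn'⟩
  have h4 : ((insert x S ∩ Set.Ico a (a + ℓ)).ncard : ℝ) ≤
      ((S ∩ Set.Ico a (a + ℓ)).ncard : ℝ) + 1 := by exact_mod_cast h3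
  linarith

theorem exists_isBlockScale {S : Set ℕ} (h0 : 0 ∈ S) (h : HasUniformDensityZero S) :
    ∃ L b, IsBlockScale S L b := by
  have key : ∀ k l : ℕ, ∃ p, 1 ≤ p ∧ (1 ≤ l →
      ∀ a, (S ∩ Set.Ico a (a + l * (l + 1) * (k + 1) * p)).ncard ≤ p) := by
    intro k l
    rcases Nat.eq_zero_or_pos l with rfl | hl
    · exact ⟨1, le_rfl, by simp⟩
    obtain ⟨N, hN⟩ := h (1 / (l * (l + 1) * (k + 1) : ℕ)) (by positivity)
    have hm : 1 ≤ l * (l + 1) * (k + 1) := by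
      have : 0 < l * (l + 1) * (k + 1) := by positivity
      exact this
    refine ⟨N + 1, by omega, fun _ a => ?_⟩
    have := hN (l * (l + 1) * (k + 1) * (N + 1)) (by nlinarith) a
    have h2 : (0 : ℝ) < ((l * (l + 1) * (k + 1) : ℕ) : ℝ) := by exact_mod_cast hm
    rw [Nat.cast_mul (l * (l + 1) * (k + 1)) (N + 1), ← mul_assoc, one_div,
      inv_mul_cancel₀ h2.ne', one_mul] at this
    exact_mod_cast this
  choose p hp1 hp using key
  -- With `b k = L k * p`, the factor `L k + 1` gives `bound_mul_lt` and `k + 1` gives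
  -- `bound_mul_le`; `p` bounds the number of points of `S` in a window of the new length.
  let L : ℕ → ℕ := fun k => Nat.rec 1 (fun k l => l * (l + 1) * (k + 1) * p k l) k
  have hL : ∀ k, L (k + 1) = L k * (L k + 1) * (k + 1) * p k (L k) := fun k => rfl
  have hpos : ∀ k, 0 < L k := by
    intro k
    induction k with
    | zero => exact one_pos
    | succ k ih =>
      rw [hL]
      have := hp1 k (L k)
      positivity
  have hlt : ∀ k, L k * p k (L k) * L k < L (k + 1) := by
    intro k
    have h1 := hp1 k (L k)
    have h2 := hpos k
    calc L k * p k (L k) * L k < L k * p k (L k) * (L k + 1) :=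
          Nat.mul_lt_mul_of_pos_left (Nat.lt_succ_self _) (by positivity)
      _ ≤ L k * p k (L k) * (L k + 1) * (k + 1) := Nat.le_mul_of_pos_right _ (by omega)
      _ = L (k + 1) := by rw [hL]; ring
  refine ⟨L, fun k => L k * p k (L k), h0, rfl, fun k => ?_, strictMono_nat_of_lt_succ fun k => ?_,
    fun k => Nat.le_mul_of_pos_right _ (hp1 _ _), fun k a => ?_, hlt, fun k => ?_⟩
  · exact ⟨(L k + 1) * (k + 1) * p k (L k), by rw [hL]; ring⟩
  · refine lt_of_le_of_lt ?_ (hlt k)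
    have := hp1 k (L k)
    have := hpos k
    exact Nat.le_mul_of_pos_left _ (by positivity)
  · rw [hL, mul_comm]
    exact Nat.mul_le_mul_left _ (hp _ _ (hpos k) a)
  · rw [hL, show L k * (L k + 1) * (k + 1) * p k (L k) =
      L k * p k (L k) * (k + 1) * (L k + 1) by ring]
    exact Nat.le_mul_of_pos_right _ (by omega)

open scoped Classical in
/-- A sequence is Weyl almost periodic if it differs from periodic sequences on sets of arbitrarily
small upper Banach density. -/
def IsWeylAlmostPeriodic {K : Type*} (y : ℕ → K) : Prop :=
  ∀ η : ℝ, 0 < η → ∃ L : ℕ, 0 < L ∧ ∃ v : ℕ → K, (∀ n, v (n + L) = v n) ∧ ∃ C : ℝ,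
    ∀ a N : ℕ, (((Finset.Ico a (a + N)).filter fun n => y n ≠ v n).card : ℝ) ≤ η * N + C

/-- Every initial segment of `y` recurs with bounded gaps. -/
def IsUniformlyRecurrentSeq {K : Type*} (y : ℕ → K) : Prop :=
  ∀ m : ℕ, ∃ M : ℕ, ∀ a, ∃ s ≤ M, ∀ i < m, y (a + s + i) = y i

open scoped Classical in
-- An interval of length `N` meets at most `N / M + 2` aligned blocks of length `M`.
theorem card_filter_Ico_le_of_blocks {P : ℕ → Prop} {M b : ℕ} (hM : 0 < M)
    (h : ∀ j, ((Finset.range M).filter fun i => P (j * M + i)).card ≤ b) (a N : ℕ) :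
    ((Finset.Ico a (a + N)).filter P).card ≤ (N / M + 2) * b := by
  refine (Finset.card_le_card (t := (Finset.Ico (a / M) (a / M + (N / M + 2))).biUnion fun j =>
    ((Finset.range M).filter fun i => P (j * M + i)).image fun i => j * M + i) ?_).trans ?_
  · intro n hn
    rw [Finset.mem_filter, Finset.mem_Ico] at hn
    obtain ⟨⟨hn1, hn2⟩, hn3⟩ := hn
    have hdm : n / M * M + n % M = n := by rw [mul_comm]; exact Nat.div_add_mod n M
    rw [Finset.mem_biUnion]
    refine ⟨n / M, ?_, ?_⟩
    · rw [Finset.mem_Ico]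
      refine ⟨Nat.div_le_div_right hn1, ?_⟩
      rw [Nat.div_lt_iff_lt_mul hM]
      have h1 := Nat.lt_mul_div_succ a hM
      have h2 := Nat.lt_mul_div_succ N hM
      calc n < a + N := hn2
        _ < M * (a / M + 1) + M * (N / M + 1) := by omega
        _ = _ := by ring
    · rw [Finset.mem_image]
      refine ⟨n % M, ?_, hdm⟩
      rw [Finset.mem_filter, Finset.mem_range, hdm]
      exact ⟨Nat.mod_lt _ hM, hn3⟩
  · refine (Finset.card_biUnion_le_card_mul _ _ b fun j _ => Finset.card_image_le.trans (h j)).trans ?_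
    simp

/-- Every function on a set of uniform density zero extends to a uniformly recurrent Weyl almost
periodic sequence. -/
theorem exists_seq_extending {K : Type*} {S : Set ℕ} (hS : HasUniformDensityZero S) (g : ℕ → K) :
    ∃ y : ℕ → K, (∀ n ∈ S, y n = g n) ∧ IsWeylAlmostPeriodic y ∧ IsUniformlyRecurrentSeq y := by
  classical
  obtain ⟨L, b, h⟩ := exists_isBlockScale (Set.mem_insert 0 S) (hasUniformDensityZero_insert hS 0)
  let f : ℕ → K := fun n => if n ∈ insert 0 S then g n else g 0
  have hf : ∀ n ∉ insert 0 S, f n = g 0 := fun n hn => if_neg hn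
  let V := blockStage (insert 0 S) L f (g 0)
  let y : ℕ → K := fun n => (V n).1 n
  have hblock : ∀ k j, ((Finset.range (L (k + 1))).filter fun i =>
      y (j * L (k + 1) + i) ≠ (V k).2 i).card ≤ b k := h.card_ne_limit_le hf
  have hper : ∀ k j n, (V k).2 (j * L k + n) = (V k).2 n := fun k j n =>
    h.snd_eq_of_mod_eq k (by rw [mul_comm, Nat.mul_add_mod])
  refine ⟨y, fun n hn => ?_, fun η hη => ?_, fun m => ?_⟩
  · have hn' : n ∈ insert 0 S := Or.inr hn
    have : y n = f n := IsBlockScale.fst_eq_of_mem n hn'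
    rw [this]
    exact if_pos hn'
  · obtain ⟨k, hk⟩ := exists_nat_one_div_lt hη
    have hper' : ∀ j i, (V k).2 (j * L (k + 1) + i) = (V k).2 i := by
      intro j i
      obtain ⟨q, hq⟩ := h.dvd k
      rw [hq, show j * (L k * q) = j * q * L k by ring, hper]
    refine ⟨L k, h.pos k, (V k).2, fun n => ?_, 2 * b k, fun a N => ?_⟩
    · simpa [add_comm] using hper k 1 n
    · have h1 := card_filter_Ico_le_of_blocks (P := fun n => y n ≠ (V k).2 n) (h.pos (k + 1))
        (b := b k) (fun j => by simpa only [hper'] using hblock k j) a N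
      have h2 : ((N / L (k + 1) : ℕ) : ℝ) * b k ≤ η * N := by
        have h3 : (N / L (k + 1)) * b k * (k + 1) ≤ N := by
          rw [mul_assoc]
          exact (Nat.mul_le_mul_left _ (h.bound_mul_le k)).trans (Nat.div_mul_le_self _ _)
        have h4 : ((N / L (k + 1) : ℕ) : ℝ) * b k * (k + 1) ≤ N := by exact_mod_cast h3
        calc ((N / L (k + 1) : ℕ) : ℝ) * b k ≤ 1 / (k + 1 : ℝ) * N := by
              rw [one_div, inv_mul_eq_div, le_div_iff₀ (by positivity)]; exact h4
          _ ≤ η * N := by gcongr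
      have h5 : (((Finset.Ico a (a + N)).filter fun n => y n ≠ (V k).2 n).card : ℝ) ≤
          ((N / L (k + 1) : ℕ) + 2) * b k := by exact_mod_cast h1
      linarith
  · have hm : m ≤ L m := h.strictMono.id_le m
    obtain ⟨q, hq⟩ := h.dvd (m + 1)
    -- One `L (m + 2)` to reach the next aligned block, and one to find a good `L (m + 1)`-block
    -- inside it.
    refine ⟨2 * L (m + 2), fun a => ?_⟩
    set j := a / L (m + 2) + 1 with hj
    have hja : a ≤ j * L (m + 2) ∧ j * L (m + 2) ≤ a + L (m + 2) := by
      have h1 := Nat.lt_mul_div_succ a (h.pos (m + 2))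
      have h2 := Nat.div_mul_le_self a (L (m + 2))
      rw [mul_comm] at h1
      rw [hj]
      refine ⟨h1.le, ?_⟩
      rw [add_mul, one_mul]
      omega
    -- Pigeonhole: the block splits into `q > b (m + 1)` subblocks, more than there are errors, so
    -- one subblock is error-free and begins with the first `L m` letters of `y`.
    have hex : ∃ t < q, ∀ i < L (m + 1),
        y (j * L (m + 2) + (t * L (m + 1) + i)) = (V (m + 1)).2 (t * L (m + 1) + i) := by
      by_contra! hcon
      have h1 : (Finset.range q).card ≤ ((Finset.range (L (m + 2))).filter fun i =>
          y (j * L (m + 2) + i) ≠ (V (m + 1)).2 i).card := by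
        refine Finset.card_le_card_of_surjOn (fun i => i / L (m + 1)) ?_
        intro t ht
        rw [Finset.mem_coe, Finset.mem_range] at ht
        obtain ⟨i, hi, hne⟩ := hcon t ht
        refine ⟨t * L (m + 1) + i, ?_, ?_⟩
        · rw [Finset.mem_coe, Finset.mem_filter, Finset.mem_range]
          refine ⟨?_, hne⟩
          rw [hq]
          nlinarith
        · simp only
          rw [mul_comm, Nat.mul_add_div (h.pos _), Nat.div_eq_of_lt hi, add_zero]
      have h2 := h.bound_mul_lt (m + 1)
      rw [hq, mul_comm] at h2
      have h3 := lt_of_mul_lt_mul_left h2 (Nat.zero_le _)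
      have h4 := hblock (m + 1) j
      rw [Finset.card_range] at h1
      exact absurd (h1.trans h4) (not_le.2 h3)
    obtain ⟨t, ht, hty⟩ := hex
    have htL : t * L (m + 1) ≤ L (m + 2) := by
      rw [hq, mul_comm]; exact Nat.mul_le_mul_left _ ht.le
    refine ⟨j * L (m + 2) + t * L (m + 1) - a, by omega, fun i hi => ?_⟩
    have hi' : i < L m := by omega
    have h1 := hty i (hi'.trans (h.strictMono (Nat.lt_succ_self m)))
    rw [hper] at h1
    rw [show a + (j * L (m + 2) + t * L (m + 1) - a) + i =
      j * L (m + 2) + (t * L (m + 1) + i) by omega, h1]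
    exact h.snd_succ_eq_limit hi'

/-! ### A criterion for unique ergodicity. -/

namespace TopDynSystem

/-- If the ergodic averages of every continuous function have arbitrarily small oscillation, the
system is uniquely ergodic. -/
theorem isUniquelyErgodic_of_oscillation_le (X : TopDynSystem) [Nonempty X]
    (h : ∀ (G : C(X, ℝ)) (ε : ℝ), 0 < ε → ∃ n : ℕ, 0 < n ∧ ∀ x x' : X,
      |∑ i ∈ Finset.range n, G (X.map^[i] x) - ∑ i ∈ Finset.range n, G (X.map^[i] x')| ≤ ε * n) :
    X.IsUniquelyErgodic := by
  let x₀ : X := Classical.arbitrary X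
  obtain ⟨μ, hμ, -⟩ := X.exists_invariant_measure_of_segments x₀ (fun _ => 0) id tendsto_id
  refine ⟨μ, hμ, fun ν hν => ?_⟩
  -- Integrating the ergodic sum against an invariant measure gives `n * ∫ G`, so every invariant
  -- integral is within `ε` of the average at `x₀`.
  have key : ∀ (G : C(X, ℝ)) (ε : ℝ) (n : ℕ), (∀ x x' : X,
      |∑ i ∈ Finset.range n, G (X.map^[i] x) - ∑ i ∈ Finset.range n, G (X.map^[i] x')| ≤ ε * n) →
      ∀ ρ : Measure X, IsProbabilityMeasure ρ ∧ MeasurePreserving X.map ρ ρ →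
        |n * ∫ z, G z ∂ρ - ∑ i ∈ Finset.range n, G (X.map^[i] x₀)| ≤ ε * n := by
    rintro G ε n hn ρ ⟨hρ, hρT⟩
    have hcont : ∀ i, Continuous fun z => G (X.map^[i] z) := fun i =>
      G.continuous.comp (X.continuous_map.iterate i)
    have hint : ∀ F : X → ℝ, Continuous F → Integrable F ρ := fun F hF =>
      (BoundedContinuousFunction.mkOfCompact ⟨F, hF⟩).integrable ρ
    have hsum : n * ∫ z, G z ∂ρ = ∫ z, ∑ i ∈ Finset.range n, G (X.map^[i] z) ∂ρ := by
      rw [integral_finsetSum _ fun i _ => hint _ (hcont i)]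
      have : ∀ i, ∫ z, G (X.map^[i] z) ∂ρ = ∫ z, G z ∂ρ := by
        intro i
        have hi := hρT.iterate i
        rw [← integral_map hi.measurable.aemeasurable G.continuous.aestronglyMeasurable, hi.map_eq]
      simp [this]
    have hcs : Continuous fun z => ∑ i ∈ Finset.range n, G (X.map^[i] z) :=
      continuous_finsetSum _ fun i _ => hcont i
    have h1 : ∫ z, (∑ i ∈ Finset.range n, G (X.map^[i] z) -
        ∑ i ∈ Finset.range n, G (X.map^[i] x₀)) ∂ρ =
        n * ∫ z, G z ∂ρ - ∑ i ∈ Finset.range n, G (X.map^[i] x₀) := by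
      rw [integral_sub (hint _ hcs) (integrable_const _), ← hsum]
      simp
    rw [← h1]
    have := norm_integral_le_of_norm_le_const (μ := ρ) (C := ε * n)
      (f := fun z => ∑ i ∈ Finset.range n, G (X.map^[i] z) -
        ∑ i ∈ Finset.range n, G (X.map^[i] x₀)) (Eventually.of_forall fun z => hn z x₀)
    simpa using this
  have := hμ.1
  have := hν.1
  refine ext_of_forall_integral_eq_of_IsFiniteMeasure fun f => ?_
  let G : C(X, ℝ) := f.toContinuousMap
  refine eq_of_forall_dist_le fun ε hε => ?_
  obtain ⟨n, hn0, hn⟩ := h G (ε / 2) (by positivity)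
  have h1 := abs_le.1 (key G _ n hn ν hν)
  have h2 := abs_le.1 (key G _ n hn μ hμ)
  have hn0' : (0 : ℝ) < n := by exact_mod_cast hn0
  change |∫ z, G z ∂ν - ∫ z, G z ∂μ| ≤ ε
  rw [abs_le]
  constructor
  · refine le_of_mul_le_mul_left ?_ hn0'
    linarith [h1.1, h2.2]
  · refine le_of_mul_le_mul_left ?_ hn0'
    linarith [h1.2, h2.1]

end TopDynSystem

/-! ### Shift orbit closures and minimality. -/

section OrbitClosure

variable {K : Type} [MetricSpace K] (y : ℕ → K)

/-- The closure of the set of all shifts of a sequence. -/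
def shiftOrbitClosure : Set (ℕ → K) := closure (Set.range fun a i => y (a + i))

namespace shiftOrbitClosure

theorem shift_mem (a : ℕ) : (fun i => y (a + i)) ∈ shiftOrbitClosure y :=
  subset_closure ⟨a, rfl⟩

theorem continuous_shift : Continuous fun (x : ℕ → K) (i : ℕ) => x (i + 1) :=
  continuous_pi fun i => continuous_apply (i + 1)

theorem mapsTo_shift :
    Set.MapsTo (fun (x : ℕ → K) (i : ℕ) => x (i + 1)) (shiftOrbitClosure y)
      (shiftOrbitClosure y) := by
  refine Set.MapsTo.closure ?_ continuous_shift
  rintro _ ⟨a, rfl⟩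
  exact ⟨a + 1, funext fun i => congrArg y (by ring)⟩

variable {y} in
theorem exists_shift_near {x : ℕ → K} (hx : x ∈ shiftOrbitClosure y) (n : ℕ) {ε : ℝ}
    (hε : 0 < ε) : ∃ a, ∀ i < n, dist (x i) (y (a + i)) < ε := by
  have ho : IsOpen {z : ℕ → K | ∀ i ∈ Finset.range n, dist (x i) (z i) < ε} := by
    have : {z : ℕ → K | ∀ i ∈ Finset.range n, dist (x i) (z i) < ε} =
        ⋂ i ∈ Finset.range n, {z : ℕ → K | dist (x i) (z i) < ε} := by
      ext; simp
    rw [this]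
    exact isOpen_biInter_finset fun i _ =>
      isOpen_lt (continuous_const.dist (continuous_apply i)) continuous_const
  obtain ⟨_, hz, a, rfl⟩ := mem_closure_iff.1 hx _ ho fun i _ => by simpa using hε
  exact ⟨a, fun i hi => hz i (Finset.mem_range.2 hi)⟩

theorem exists_of_mem_uniformity {U : Set (shiftOrbitClosure y × shiftOrbitClosure y)}
    (hU : U ∈ 𝓤 (shiftOrbitClosure y)) :
    ∃ (m : ℕ) (δ : ℝ), 0 < δ ∧ ∀ x x' : shiftOrbitClosure y,
      (∀ i < m, dist (x.1 i) (x'.1 i) < δ) → (x, x') ∈ U := by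
  rw [uniformity_subtype, Filter.mem_comap] at hU
  obtain ⟨V, hV, hVU⟩ := hU
  rw [Pi.uniformity, Filter.mem_iInf'] at hV
  obtain ⟨I, hI, W, hW, -, hVW, -⟩ := hV
  have : ∀ i, ∃ δ : ℝ, 0 < δ ∧ ∀ x x' : ℕ → K, dist (x i) (x' i) < δ → (x, x') ∈ W i := by
    intro i
    obtain ⟨W', hW', hWW'⟩ := Filter.mem_comap.1 (hW i)
    obtain ⟨δ, hδ, hδW⟩ := Metric.mem_uniformity_dist.1 hW'
    exact ⟨δ, hδ, fun x x' hd => hWW' (hδW hd)⟩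
  choose δ hδ hδW using this
  obtain ⟨m, hm⟩ := hI.bddAbove
  obtain ⟨δ', hδ', hδ'le⟩ : ∃ δ' : ℝ, 0 < δ' ∧ ∀ i ∈ Finset.range (m + 1), δ' ≤ δ i := by
    obtain ⟨i₀, -, hi₀⟩ := (Finset.range (m + 1)).exists_min_image δ ⟨0, by simp⟩
    exact ⟨δ i₀, hδ i₀, hi₀⟩
  refine ⟨m + 1, δ', hδ', fun x x' hxx' => hVU ?_⟩
  change (x.1, x'.1) ∈ V
  rw [hVW]
  refine Set.mem_iInter₂.2 fun i hi => ?_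
  have hi' : i < m + 1 := Nat.lt_succ_of_le (hm hi)
  exact hδW i _ _ ((hxx' i hi').trans_le (hδ'le i (Finset.mem_range.2 hi')))

end shiftOrbitClosure

variable [CompactSpace K]

/-- The shift on the orbit closure of a sequence in a compact metric space. -/
noncomputable def shiftSystem : TopDynSystem where
  carrier := shiftOrbitClosure y
  -- Any metric inducing the product uniformity serves, since estimates are made on finitely many
  -- coordinates.
  metric := UniformSpace.metricSpace _
  compact := isCompact_iff_compactSpace.1 isClosed_closure.isCompact
  map := (shiftOrbitClosure.mapsTo_shift y).restrict
  continuous_map := shiftOrbitClosure.continuous_shift.restrict (shiftOrbitClosure.mapsTo_shift y)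

namespace shiftSystem

/-- The sequence underlying a point of the orbit closure. -/
def toSeq (x : shiftSystem y) : ℕ → K := x.1

/-- The point of the orbit closure given by a shift of the sequence. -/
def shiftPoint (a : ℕ) : shiftSystem y := ⟨_, shiftOrbitClosure.shift_mem y a⟩

instance : Nonempty (shiftSystem y) := ⟨shiftPoint y 0⟩

variable {y}

@[simp]
theorem toSeq_shiftPoint (a i : ℕ) : toSeq y (shiftPoint y a) i = y (a + i) := rfl

theorem continuous_toSeq (i : ℕ) : Continuous fun x => toSeq y x i :=
  (continuous_apply i).comp continuous_subtype_val

theorem toSeq_iterate (x : shiftSystem y) (n i : ℕ) :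
    toSeq y ((shiftSystem y).map^[n] x) i = toSeq y x (n + i) := by
  induction n generalizing i with
  | zero => simp
  | succ n ih =>
    rw [Function.iterate_succ_apply']
    have := ih (i + 1)
    rw [show n + 1 + i = n + (i + 1) by ring]
    exact this

theorem exists_shift_near (x : shiftSystem y) (n : ℕ) {ε : ℝ} (hε : 0 < ε) :
    ∃ a, ∀ i < n, dist (toSeq y x i) (y (a + i)) < ε :=
  shiftOrbitClosure.exists_shift_near x.2 n hε

theorem exists_of_mem_uniformity {U : Set (shiftSystem y × shiftSystem y)}
    (hU : U ∈ 𝓤 (shiftSystem y)) :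
    ∃ (m : ℕ) (δ : ℝ), 0 < δ ∧ ∀ x x' : shiftSystem y,
      (∀ i < m, dist (toSeq y x i) (toSeq y x' i) < δ) → (x, x') ∈ U :=
  shiftOrbitClosure.exists_of_mem_uniformity y hU

/-- The target `z` is near `y` shifted by `a`, so it is determined up to a small error by the first
`a + m` letters of `y`; these recur within `M` steps in any stretch of `y` that shadows `x`. -/
theorem isMinimal (hy : IsUniformlyRecurrentSeq y) : (shiftSystem y).IsMinimal := by
  intro x z
  rw [UniformSpace.mem_closure_iff_ball]
  intro U hU
  obtain ⟨m, δ, hδ, hmU⟩ := exists_of_mem_uniformity hU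
  obtain ⟨a, ha⟩ := exists_shift_near z m (half_pos hδ)
  obtain ⟨M, hM⟩ := hy (a + m)
  obtain ⟨b, hb⟩ := exists_shift_near x (M + a + m) (half_pos hδ)
  obtain ⟨s, hsM, hs⟩ := hM b
  refine ⟨_, hmU z _ fun i hi => ?_, ⟨s + a, rfl⟩⟩
  rw [toSeq_iterate]
  have h1 := ha i hi
  have h2 := hb (s + a + i) (by omega)
  have h3 := hs (a + i) (by omega)
  rw [show b + (s + a + i) = b + s + (a + i) by ring, h3, dist_comm] at h2
  calc dist (toSeq y z i) (toSeq y x (s + a + i)) ≤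
      dist (toSeq y z i) (y (a + i)) + dist (y (a + i)) (toSeq y x (s + a + i)) :=
        dist_triangle _ _ _
    _ < δ := by linarith

end shiftSystem

end OrbitClosure

/-! ### Unique ergodicity from Weyl almost periodicity. -/

theorem abs_sum_range_shift_sub_le {u : ℕ → ℝ} {C : ℝ} (hu : ∀ i, |u i| ≤ C) (b r n : ℕ) :
    |∑ i ∈ Finset.range n, u (b + r + i) - ∑ i ∈ Finset.range n, u (b + i)| ≤ 2 * r * C := by
  induction r with
  | zero => simp
  | succ r ih =>
    have h1 : ∑ i ∈ Finset.range n, u (b + (r + 1) + i) - ∑ i ∈ Finset.range n, u (b + r + i) =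
        u (b + r + n) - u (b + r + 0) := by
      rw [← Finset.sum_range_sub (fun i => u (b + r + i)), ← Finset.sum_sub_distrib]
      refine Finset.sum_congr rfl fun i _ => ?_
      rw [show b + (r + 1) + i = b + r + (i + 1) by ring]
    have h2 := abs_sub (u (b + r + n)) (u (b + r + 0))
    rw [← h1] at h2
    have h3 := abs_sub_le (∑ i ∈ Finset.range n, u (b + (r + 1) + i))
      (∑ i ∈ Finset.range n, u (b + r + i)) (∑ i ∈ Finset.range n, u (b + i))
    push_cast
    linarith [hu (b + r + n), hu (b + r + 0)]

open scoped Classical in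
theorem card_filter_exists_ne_le {K : Type*} {y v : ℕ → K} {η C : ℝ}
    (h : ∀ a N : ℕ, (((Finset.Ico a (a + N)).filter fun n => y n ≠ v n).card : ℝ) ≤ η * N + C)
    (a n m : ℕ) :
    (((Finset.range n).filter fun i => ∃ j < m, y (a + i + j) ≠ v (a + i + j)).card : ℝ) ≤
      m * (η * n + C) := by
  have h1 : ((Finset.range n).filter fun i => ∃ j < m, y (a + i + j) ≠ v (a + i + j)).card ≤
      ∑ j ∈ Finset.range m,
        ((Finset.Ico (a + j) (a + j + n)).filter fun n => y n ≠ v n).card := by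
    refine (Finset.card_le_card (t := (Finset.range m).biUnion fun j =>
      (Finset.range n).filter fun i => y (a + i + j) ≠ v (a + i + j)) ?_).trans
      (Finset.card_biUnion_le.trans (Finset.sum_le_sum fun j _ => ?_))
    · intro i hi
      rw [Finset.mem_filter] at hi
      obtain ⟨hi1, j, hj, hne⟩ := hi
      exact Finset.mem_biUnion.2 ⟨j, Finset.mem_range.2 hj, Finset.mem_filter.2 ⟨hi1, hne⟩⟩
    · refine Finset.card_le_card_of_injOn (fun i => a + i + j) ?_ ?_
      · intro i hi
        rw [Finset.mem_coe, Finset.mem_filter, Finset.mem_range] at hi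
        rw [Finset.mem_coe, Finset.mem_filter, Finset.mem_Ico]
        exact ⟨⟨by simp only; omega, by simp only; omega⟩, hi.2⟩
      · intro i _ i' _ hii
        simp only at hii
        omega
  have h2 : (((Finset.range n).filter fun i => ∃ j < m, y (a + i + j) ≠ v (a + i + j)).card : ℝ) ≤
      ∑ j ∈ Finset.range m,
        (((Finset.Ico (a + j) (a + j + n)).filter fun n => y n ≠ v n).card : ℝ) := by
    exact_mod_cast h1
  refine h2.trans ((Finset.sum_le_sum fun j _ => h (a + j) n).trans ?_)
  simp [mul_add]

theorem periodic_add_mul {K : Type*} {v : ℕ → K} {L : ℕ} (hv : ∀ n, v (n + L) = v n) (q n : ℕ) :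
    v (n + L * q) = v n := by
  induction q with
  | zero => rfl
  | succ q ih => rw [Nat.mul_succ, ← add_assoc, hv, ih]

namespace shiftSystem

variable {K : Type} [MetricSpace K] [CompactSpace K] {y : ℕ → K}

open scoped Classical in
/-- Two stretches of a Weyl almost periodic sequence whose starting points are congruent modulo
the almost period have close averages. -/
theorem abs_sum_shiftPoint_sub_le {G : shiftSystem y → ℝ} {C ε η C' : ℝ} (hε : 0 ≤ ε)
    (hC : ∀ x, |G x| ≤ C) {m : ℕ} (hm : ∀ a b, (∀ i < m, y (a + i) = y (b + i)) →
      |G (shiftPoint y a) - G (shiftPoint y b)| ≤ ε) {v : ℕ → K} {a b : ℕ}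
    (hv : ∀ i, v (a + i) = v (b + i))
    (h : ∀ a N : ℕ, (((Finset.Ico a (a + N)).filter fun n => y n ≠ v n).card : ℝ) ≤ η * N + C')
    (n : ℕ) :
    |∑ i ∈ Finset.range n, G (shiftPoint y (a + i)) -
      ∑ i ∈ Finset.range n, G (shiftPoint y (b + i))| ≤ ε * n + 4 * C * m * (η * n + C') := by
  rw [← Finset.sum_sub_distrib]
  refine (Finset.abs_sum_le_sum_abs _ _).trans ?_
  have hC0 : 0 ≤ C := (abs_nonneg _).trans (hC (shiftPoint y 0))
  let bad : ℕ → ℕ → ℝ := fun c i => if ∃ j < m, y (c + i + j) ≠ v (c + i + j) then 1 else 0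
  have hbad0 : ∀ c i, 0 ≤ bad c i := by
    intro c i
    simp only [bad]
    split_ifs <;> norm_num
  -- If both `m`-windows agree with `v` they agree with each other and the values of `G` are close;
  -- otherwise the trivial bound `2 * C` is charged to `bad`.
  have hpt : ∀ i, |G (shiftPoint y (a + i)) - G (shiftPoint y (b + i))| ≤
      ε + 2 * C * (bad a i + bad b i) := by
    intro i
    have htriv := abs_sub (G (shiftPoint y (a + i))) (G (shiftPoint y (b + i)))
    have h1 := hC (shiftPoint y (a + i))
    have h2 := hC (shiftPoint y (b + i))
    by_cases ha : ∃ j < m, y (a + i + j) ≠ v (a + i + j)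
    · have : bad a i = 1 := if_pos ha
      have := hbad0 b i
      nlinarith
    by_cases hb : ∃ j < m, y (b + i + j) ≠ v (b + i + j)
    · have : bad b i = 1 := if_pos hb
      have := hbad0 a i
      nlinarith
    push Not at ha hb
    have := hm (a + i) (b + i) fun j hj => by
      rw [ha j hj, hb j hj, add_assoc, add_assoc, hv]
    nlinarith [hbad0 a i, hbad0 b i]
  have hbads : ∀ c, ∑ i ∈ Finset.range n, bad c i ≤ m * (η * n + C') := by
    intro c
    have := card_filter_exists_ne_le h c n m
    rw [Finset.card_filter] at this
    push_cast at this
    exact this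
  calc _ ≤ ∑ i ∈ Finset.range n, (ε + 2 * C * (bad a i + bad b i)) :=
        Finset.sum_le_sum fun i _ => hpt i
    _ = ε * n + 2 * C * (∑ i ∈ Finset.range n, bad a i + ∑ i ∈ Finset.range n, bad b i) := by
        rw [Finset.sum_add_distrib, ← Finset.mul_sum, Finset.sum_add_distrib]
        simp [mul_comm]
    _ ≤ ε * n + 2 * C * (m * (η * n + C') + m * (η * n + C')) := by
        gcongr
        · exact hbads a
        · exact hbads b
    _ = _ := by ring

theorem isUniquelyErgodic (hy : IsWeylAlmostPeriodic y) : (shiftSystem y).IsUniquelyErgodic := by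
  refine TopDynSystem.isUniquelyErgodic_of_oscillation_le _ fun G ε hε => ?_
  obtain ⟨C, hC0, hC⟩ := TopDynSystem.exists_norm_le _ G
  have hunif := CompactSpace.uniformContinuous_of_continuous G.continuous
  obtain ⟨m, δ, hδ, hm⟩ := exists_of_mem_uniformity
    (hunif (Metric.dist_mem_uniformity (show (0 : ℝ) < ε / 8 by positivity)))
  have hm' : ∀ x x' : shiftSystem y, (∀ i < m, dist (toSeq y x i) (toSeq y x' i) < δ) →
      |G x - G x'| ≤ ε / 8 := fun x x' hxx' => le_of_lt (hm x x' hxx')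
  obtain ⟨L, hL, v, hv, C', hvy⟩ := hy (ε / (8 * (4 * C * m + 1))) (by positivity)
  have hη : 4 * C * m * (ε / (8 * (4 * C * m + 1))) ≤ ε / 8 := by
    rw [show ε / (8 * (4 * C * m + 1)) = (ε / 8) / (4 * C * m + 1) by field_simp,
      mul_div_assoc', div_le_iff₀ (by positivity)]
    nlinarith
  set η := ε / (8 * (4 * C * m + 1))
  obtain ⟨n, hn⟩ := exists_nat_gt ((4 * C * m * C' + 2 * L * C) * (8 / ε))
  have hn' : 4 * C * m * C' + 2 * L * C ≤ ε / 8 * (n + 1) := by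
    have h1 : (4 * C * m * C' + 2 * L * C) * (8 / ε) ≤ n + 1 := by linarith
    have h2 := mul_le_mul_of_nonneg_left h1 (show 0 ≤ ε / 8 by positivity)
    have h3 : ε / 8 * ((4 * C * m * C' + 2 * L * C) * (8 / ε)) = 4 * C * m * C' + 2 * L * C := by
      field_simp
    linarith
  refine ⟨n + 1, Nat.succ_pos n, ?_⟩
  have hnear : ∀ x : shiftSystem y, ∃ a,
      |∑ i ∈ Finset.range (n + 1), G ((shiftSystem y).map^[i] x) -
        ∑ i ∈ Finset.range (n + 1), G (shiftPoint y (a + i))| ≤ ε / 8 * (n + 1) := by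
    intro x
    obtain ⟨a, ha⟩ := exists_shift_near x (n + 1 + m) hδ
    refine ⟨a, ?_⟩
    rw [← Finset.sum_sub_distrib]
    refine (Finset.abs_sum_le_sum_abs _ _).trans ((Finset.sum_le_sum (g := fun _ => ε / 8)
      fun i hi => hm' _ _ fun j hj => ?_).trans ?_)
    · rw [Finset.mem_range] at hi
      rw [toSeq_iterate, toSeq_shiftPoint, add_assoc]
      exact ha (i + j) (by omega)
    · simp [mul_comm]
  have hpts : ∀ a b : ℕ, |∑ i ∈ Finset.range (n + 1), G (shiftPoint y (a + i)) -
      ∑ i ∈ Finset.range (n + 1), G (shiftPoint y (b + i))| ≤ 3 * (ε / 8 * (n + 1)) := by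
    intro a b
    -- Shifting `b` by `r < L` aligns it with `a` modulo the period, at a cost of at most `2 * L *
    -- C` independent of `n`.
    obtain ⟨r, hr, q, q', hq⟩ : ∃ r < L, ∃ q q', a + L * q = b + r + L * q' := by
      have ha := Nat.div_add_mod a L
      have hb := Nat.div_add_mod b L
      have ha' := Nat.mod_lt a hL
      have hb' := Nat.mod_lt b hL
      by_cases hab : b % L ≤ a % L
      · refine ⟨a % L - b % L, by omega, b / L, a / L, by omega⟩
      · refine ⟨a % L + L - b % L, by omega, b / L + 1, a / L, ?_⟩
        rw [Nat.mul_succ]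
        omega
    have h1 := abs_sum_range_shift_sub_le (u := fun i => G (shiftPoint y i)) (fun i => hC _) b r
      (n + 1)
    have h2 := abs_sum_shiftPoint_sub_le (G := G) (a := a) (b := b + r) (v := v)
      (show 0 ≤ ε / 8 by positivity) hC (m := m)
      (fun a b hab => hm' _ _ fun i hi => by
        rw [toSeq_shiftPoint, toSeq_shiftPoint, hab i hi, dist_self]; exact hδ)
      (fun i => by
        rw [← periodic_add_mul hv q, ← periodic_add_mul hv q' (b + r + i),
          show a + i + L * q = a + L * q + i by ring, hq,
          show b + r + L * q' + i = b + r + i + L * q' by ring]) hvy (n + 1)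
    have h3 := abs_sub_le (∑ i ∈ Finset.range (n + 1), G (shiftPoint y (a + i)))
      (∑ i ∈ Finset.range (n + 1), G (shiftPoint y (b + r + i)))
      (∑ i ∈ Finset.range (n + 1), G (shiftPoint y (b + i)))
    push_cast at h2
    have h4 : 2 * r * C ≤ 2 * L * C := by
      have : (r : ℝ) ≤ L := by exact_mod_cast hr.le
      gcongr
    have h5 : 4 * C * m * η * (n + 1) ≤ ε / 8 * (n + 1) := by gcongr
    linarith
  intro x x'
  obtain ⟨a, ha⟩ := hnear x
  obtain ⟨b, hb⟩ := hnear x'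
  have h1 := abs_le.1 ha
  have h2 := abs_le.1 hb
  have h3 := abs_le.1 (hpts a b)
  have h4 : 0 ≤ ε / 8 * (n + 1) := by positivity
  push_cast
  rw [abs_le]
  constructor <;> linarith [h1.1, h1.2, h2.1, h2.2, h3.1, h3.2]

end shiftSystem

/-! ### Zero entropy by counting words. -/

/-- A Chernoff bound for the number of words in a Hamming ball. -/
theorem card_hamming_ball_le {α : Type*} [Fintype α] [DecidableEq α] {N : ℕ} (u : Fin N → α)
    {κ E : ℝ} (hκ : 0 ≤ κ) :
    ((Finset.univ.filter fun w : Fin N → α =>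
      ((Finset.univ.filter fun i => w i ≠ u i).card : ℝ) ≤ E).card : ℝ) ≤
      Real.exp (κ * E + N * (Fintype.card α * Real.exp (-κ))) := by
  set τ := Real.exp (-κ) with hτ
  have hτ0 : 0 < τ := Real.exp_pos _
  -- The generating function of the Hamming distance factorises over coordinates; Markov's
  -- inequality then counts the ball.
  have h1 : ∑ w : Fin N → α, τ ^ (Finset.univ.filter fun i => w i ≠ u i).card =
      ∏ i : Fin N, ∑ a : α, if a ≠ u i then τ else 1 := by
    rw [Finset.prod_univ_sum, Fintype.piFinset_univ]
    refine Finset.sum_congr rfl fun w _ => ?_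
    rw [Finset.prod_ite]
    simp
  have h2 : ∀ i : Fin N, (∑ a : α, if a ≠ u i then τ else 1) ≤
      Real.exp (Fintype.card α * τ) := by
    intro i
    refine le_trans ?_ (Real.add_one_le_exp _)
    calc (∑ a : α, if a ≠ u i then τ else 1) ≤ ∑ a : α, (τ + if a = u i then 1 else 0) := by
          refine Finset.sum_le_sum fun a _ => ?_
          by_cases ha : a = u i <;> simp [ha, hτ0.le]
      _ = Fintype.card α * τ + 1 := by
          rw [Finset.sum_add_distrib]
          simp
  have h3 : ∑ w : Fin N → α, τ ^ (Finset.univ.filter fun i => w i ≠ u i).card ≤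
      Real.exp (N * (Fintype.card α * τ)) := by
    rw [h1]
    refine (Finset.prod_le_prod (fun i _ => Finset.sum_nonneg fun a _ => ?_)
      fun i _ => h2 i).trans ?_
    · split_ifs <;> positivity
    · simp [← Real.exp_nat_mul]
  have h4 : ((Finset.univ.filter fun w : Fin N → α =>
      ((Finset.univ.filter fun i => w i ≠ u i).card : ℝ) ≤ E).card : ℝ) * Real.exp (-(κ * E)) ≤
      ∑ w : Fin N → α, τ ^ (Finset.univ.filter fun i => w i ≠ u i).card := by
    rw [← nsmul_eq_mul]
    refine (Finset.card_nsmul_le_sum _ _ _ fun w hw => ?_).trans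
      (Finset.sum_le_sum_of_subset_of_nonneg (Finset.filter_subset _ _) fun w _ _ => by positivity)
    rw [Finset.mem_filter] at hw
    rw [hτ, ← Real.exp_nat_mul]
    refine Real.exp_le_exp.2 ?_
    nlinarith [hw.2]
  have h5 := h4.trans h3
  rw [Real.exp_add]
  calc _ = _ * Real.exp (-(κ * E)) * Real.exp (κ * E) := by
        rw [mul_assoc, ← Real.exp_add, neg_add_cancel, Real.exp_zero, mul_one]
    _ ≤ Real.exp (N * (Fintype.card α * τ)) * Real.exp (κ * E) := by gcongr
    _ = _ := mul_comm _ _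

namespace shiftSystem

variable {K : Type} [MetricSpace K] [CompactSpace K] {y : ℕ → K}

theorem exists_dynCover (hy : IsWeylAlmostPeriodic y) {U : Set (shiftSystem y × shiftSystem y)}
    (hU : U ∈ 𝓤 (shiftSystem y)) {ε : ℝ} (hε : 0 < ε) :
    ∃ n : ℕ, n ≠ 0 ∧ ∃ s : Finset (shiftSystem y),
      Dynamics.IsDynCoverOf (shiftSystem y).map Set.univ U n (s : Set (shiftSystem y)) ∧
        (s.card : ℝ) ≤ Real.exp (ε * n) := by
  classical
  obtain ⟨m, δ, hδ, hm⟩ := exists_of_mem_uniformity hU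
  obtain ⟨t, -, ht⟩ := (isCompact_univ (X := K)).elim_nhds_subcover
    (fun z => Metric.ball z (δ / 4)) fun z _ => Metric.ball_mem_nhds z (by positivity)
  have hq : ∀ z : K, ∃ p : t, dist z p < δ / 4 := by
    intro z
    obtain ⟨p, hp, hzp⟩ := Set.mem_iUnion₂.1 (ht (Set.mem_univ z))
    exact ⟨⟨p, hp⟩, hzp⟩
  choose q hq using hq
  obtain ⟨κ, hκ0, hκ⟩ : ∃ κ : ℝ, 0 < κ ∧ (Fintype.card t : ℝ) * Real.exp (-κ) ≤ ε / 4 := by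
    have h1 : Tendsto (fun κ : ℝ => (Fintype.card t : ℝ) * Real.exp (-κ)) atTop (𝓝 0) := by
      simpa using (Real.tendsto_exp_neg_atTop_nhds_zero).const_mul (Fintype.card t : ℝ)
    obtain ⟨κ, h2, h3⟩ := ((h1.eventually_le_const (show (0 : ℝ) < ε / 4 by positivity)).and
      (eventually_gt_atTop 0)).exists
    exact ⟨κ, h3, h2⟩
  -- The Chernoff exponent per letter is `κ` times this density plus `Fintype.card t * exp (-κ)`, at
  -- most `ε / 4 + ε / 4`; the other `ε / 2` absorbs the constants for large `n`.
  obtain ⟨L, hL, v, hv, C, hC⟩ := hy (ε / (4 * κ)) (by positivity)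
  obtain ⟨n, hn⟩ := exists_nat_gt ((L + κ * C + m * (ε / 2)) / (ε / 2))
  rw [div_lt_iff₀ (by positivity)] at hn
  have hnear := fun x : shiftSystem y =>
    exists_shift_near x (n + 1 + m) (show 0 < δ / 4 by positivity)
  choose A hA using hnear
  -- Quantised words of a stretch of `y` shadowing `x`. Each lies near one of the `L` quantised
  -- words of `v`, and points with equal words are `δ`-close (four errors of `δ / 4`).
  let word : shiftSystem y → Fin (n + 1 + m) → t := fun x i => q (y (A x + i))
  let ref : ℕ → Fin (n + 1 + m) → t := fun r i => q (v (r + i))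
  set E : ℝ := ε / (4 * κ) * (n + 1 + m : ℕ) + C with hE
  let W : Finset (Fin (n + 1 + m) → t) := (Finset.range L).biUnion fun r =>
    Finset.univ.filter fun w => ((Finset.univ.filter fun i => w i ≠ ref r i).card : ℝ) ≤ E
  have hword : ∀ x, word x ∈ W := by
    intro x
    refine Finset.mem_biUnion.2 ⟨A x % L, Finset.mem_range.2 (Nat.mod_lt _ hL),
      Finset.mem_filter.2 ⟨Finset.mem_univ _, ?_⟩⟩
    refine le_trans ?_ (hC (A x) (n + 1 + m))
    norm_cast
    refine Finset.card_le_card_of_injOn (fun i => A x + i) ?_ ?_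
    · intro i hi
      rw [Finset.mem_coe, Finset.mem_filter] at hi
      rw [Finset.mem_coe, Finset.mem_filter, Finset.mem_Ico]
      have hi2 := i.2
      refine ⟨⟨by simp only; omega, by simp only; omega⟩, fun heq => hi.2 ?_⟩
      have h1 : v (A x + i) = v (A x % L + i) := by
        rw [← periodic_add_mul hv (A x / L) (A x % L + i)]
        congr 1
        have := Nat.mod_add_div (A x) L
        omega
      simp only at heq
      simp only [word, ref]
      rw [heq, h1]
    · intro i _ i' _ hii
      simp only at hii
      exact Fin.ext (by omega)
  -- One point for each realised word; the value at other words is immaterial.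
  let rep : (Fin (n + 1 + m) → t) → shiftSystem y := fun w =>
    if h : ∃ x, word x = w then h.choose else shiftPoint y 0
  have hrep : ∀ x, word (rep (word x)) = word x := by
    intro x
    have h : ∃ x', word x' = word x := ⟨x, rfl⟩
    simp only [rep, dif_pos h]
    exact h.choose_spec
  refine ⟨n + 1, Nat.succ_ne_zero n, W.image rep, ?_, ?_⟩
  · intro x _
    refine ⟨rep (word x), Finset.mem_coe.2 (Finset.mem_image_of_mem _ (hword x)), ?_⟩
    rw [Dynamics.mem_dynEntourage]
    intro k hk
    refine hm _ _ fun i hi => ?_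
    rw [toSeq_iterate, toSeq_iterate]
    have hki : k + i < n + 1 + m := by omega
    have h1 := hA x (k + i) hki
    have h2 := hA (rep (word x)) (k + i) hki
    have h3 := hq (y (A x + (k + i)))
    have h4 := hq (y (A (rep (word x)) + (k + i)))
    have h5 : q (y (A (rep (word x)) + (k + i))) = q (y (A x + (k + i))) :=
      congrFun (hrep x) ⟨k + i, hki⟩
    rw [h5, dist_comm] at h4
    rw [dist_comm] at h2
    have h6 := dist_triangle4 (toSeq y x (k + i)) (y (A x + (k + i)))
      (q (y (A x + (k + i))) : K) (toSeq y (rep (word x)) (k + i))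
    have h7 := dist_triangle (q (y (A x + (k + i))) : K) (y (A (rep (word x)) + (k + i)))
      (toSeq y (rep (word x)) (k + i))
    linarith
  · have hcard : (W.card : ℝ) ≤ L * Real.exp (κ * E + (n + 1 + m : ℕ) *
        (Fintype.card t * Real.exp (-κ))) := by
      have h1 : (W.card : ℝ) ≤ ∑ r ∈ Finset.range L, ((Finset.univ.filter fun w : Fin (n + 1 + m) → t =>
          ((Finset.univ.filter fun i => w i ≠ ref r i).card : ℝ) ≤ E).card : ℝ) := by
        exact_mod_cast Finset.card_biUnion_le
      refine h1.trans ((Finset.sum_le_sum fun r _ =>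
        card_hamming_ball_le (ref r) (E := E) hκ0.le).trans ?_)
      simp
    have hLexp : (L : ℝ) ≤ Real.exp L := by linarith [Real.add_one_le_exp (L : ℝ)]
    have h2 : ((W.image rep).card : ℝ) ≤ W.card := by exact_mod_cast Finset.card_image_le
    refine (h2.trans hcard).trans ((mul_le_mul_of_nonneg_right hLexp (Real.exp_pos _).le).trans ?_)
    rw [← Real.exp_add]
    refine Real.exp_le_exp.2 ?_
    have h3 : κ * E = ε / 4 * (n + 1 + m : ℕ) + κ * C := by
      rw [hE]; field_simp
    have h4 : ((n + 1 + m : ℕ) : ℝ) * (Fintype.card t * Real.exp (-κ)) ≤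
        (n + 1 + m : ℕ) * (ε / 4) := by gcongr
    rw [h3]
    push_cast at h4 ⊢
    linarith

theorem entropy_eq_zero (hy : IsWeylAlmostPeriodic y) : (shiftSystem y).entropy = 0 := by
  refine le_antisymm ?_ (Dynamics.coverEntropy_nonneg _ Set.univ_nonempty)
  refine iSup₂_le fun U hU => ?_
  -- A cover at a single time `n` bounds the entropy by submultiplicativity, at the price of
  -- enlarging `V` to `V ○ V`.
  obtain ⟨V, hV, hVsymm, hVU⟩ := comp_symm_mem_uniformity_sets hU
  refine (Dynamics.coverEntropyEntourage_antitone _ _ hVU).trans ?_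
  rw [← EReal.le_of_forall_lt_iff_le]
  intro ε hε
  have hε' : 0 < ε := by exact_mod_cast hε
  obtain ⟨n, hn, s, hs, hcard⟩ := exists_dynCover hy hV hε'
  refine (hs.coverEntropyEntourage_le_log_card_div (Set.mapsTo_univ _ _) hn).trans ?_
  have hn' : (0 : EReal) < n := by exact_mod_cast Nat.pos_of_ne_zero hn
  rw [EReal.div_le_iff_le_mul hn' (EReal.natCast_ne_top n)]
  have h1 : ((s.card : ℕ) : ENNReal) ≤ ENNReal.ofReal (Real.exp (ε * n)) := by
    rw [← ENNReal.ofReal_natCast]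
    exact ENNReal.ofReal_le_ofReal hcard
  refine (ENNReal.log_monotone h1).trans ?_
  rw [ENNReal.log_ofReal_of_pos (Real.exp_pos _), Real.log_exp, mul_comm]
  push_cast
  rfl

end shiftSystem

/-! ### Interpolation and the equivalences. -/

theorem isInterpolationSet_strictlyErgodic_entropy_zero {S : Set ℕ}
    (hS : HasUniformDensityZero S) :
    IsInterpolationSet {X | X.IsStrictlyErgodic ∧ X.entropy = 0} S := by
  classical
  rintro f ⟨M, hM⟩
  -- For empty `S` the bound `M` may be negative; `|M|` keeps 0 in the disc.
  let g : ℕ → Metric.closedBall (0 : ℂ) |M| := fun n =>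
    if hn : n ∈ S then ⟨f ⟨n, hn⟩, by simpa using (hM ⟨n, hn⟩).trans (le_abs_self M)⟩
    else ⟨0, by simp⟩
  obtain ⟨y, hyg, hyW, hyR⟩ := exists_seq_extending hS g
  have := isCompact_iff_compactSpace.1 (isCompact_closedBall (0 : ℂ) |M|)
  have hmin := shiftSystem.isMinimal hyR
  refine ⟨shiftSystem y, ⟨⟨shiftSystem.isUniquelyErgodic hyW, hmin⟩,
    shiftSystem.entropy_eq_zero hyW⟩, shiftSystem.shiftPoint y 0, hmin _,
    ⟨fun x => (shiftSystem.toSeq y x 0).1,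
      continuous_subtype_val.comp (shiftSystem.continuous_toSeq 0)⟩, fun n => ?_⟩
  simp only [ContinuousMap.coe_mk]
  rw [shiftSystem.toSeq_iterate, shiftSystem.toSeq_shiftPoint, add_zero, zero_add, hyg n n.2]
  simp [g]

theorem IsInterpolationSet.mono {C D : Set TopDynSystem} (hCD : C ⊆ D) {S : Set ℕ}
    (h : IsInterpolationSet C S) : IsInterpolationSet D S := by
  intro f hf
  obtain ⟨X, hX, rest⟩ := h f hf
  exact ⟨X, hCD hX, rest⟩

theorem IsInterpolationSet.isWeakInterpolationSetOfAllOrders {C : Set TopDynSystem} {S : Set ℕ}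
    (h : IsInterpolationSet C S) : IsWeakInterpolationSetOfAllOrders C S := by
  intro k _ f
  refine h (fun n => ((f n : ℕ) : ℂ)) ⟨k, fun n => ?_⟩
  rw [Complex.norm_natCast]
  exact_mod_cast (f n).2.le

theorem mainTheorem3 (S : Set ℕ) (hS : ∀ n ∈ S, 1 ≤ n) :
    List.TFAE [
      IsWeakInterpolationSetOfAllOrders {X | X.IsUniquelyErgodic} S,
      IsInterpolationSet {X | X.IsUniquelyErgodic} S,
      IsInterpolationSet {X | X.IsStrictlyErgodic} S,
      IsInterpolationSet {X | X.IsStrictlyErgodic ∧ X.entropy = 0} S,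
      upperBanachDensity S = 0] := by
  tfae_have 1 → 5 := upperBanachDensity_eq_zero_of_isWeakInterpolationSetOfAllOrders
  tfae_have 5 → 4 := fun h => isInterpolationSet_strictlyErgodic_entropy_zero
    fun _ hε => le_ncard_of_upperBanachDensity_eq_zero hS h hε
  tfae_have 4 → 3 := fun h => h.mono fun _ hX => hX.1
  tfae_have 3 → 2 := fun h => h.mono fun _ hX => hX.1
  tfae_have 2 → 1 := fun h => h.isWeakInterpolationSetOfAllOrders
  tfae_finish
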